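/- **Setting.** Fix integers $n,T,d\ge 0$ (number of clients, of rounds, and dimension), a set $\Pi$ of subsets of $[T]$ (the participation schema), an invertible matrix $\mathbf C\in\mathbb R^{T\times T}$, $\zeta>0$, $\sigma>0$, $\theta_0\in\mathbb R^d$, a set $C_{\rm corrupted}\subseteq[n]$ and $\delta_{\rm privacy}\in[0,1]$. A data set $D=(X_1,\dots,X_n)$ has one entry per client, which is either an element of a data universe $\mathcal X$ or the symbol $\bot$ (the client's contribution is zeroed out). $D,D'$ are adjacent if they differ in exactly one entry, and that entry is $\bot$ in exactly one of them. The training losses are functions $\mathrm{loss}_k(x,\cdot):\mathbb R^d\to\mathbb R$ ($k\in[T]$, $x\in\mathcal X$), differentiable in the model; they may or may not depend on the round $k$. Put $\mathrm{clip}(v,\zeta)=\min(1,\zeta/\|v\|)\,v$ (and $\mathrm{clip}(0,\zeta)=0$). For a participation history $H=(H_1,\dots,H_n)$ with $H_j\subseteq[T]$, let $f_{\rm qualify}(\Pi,H,k)$ be the set of all $j\in[n]$ for which some $\pi\in\Pi$ contains $H_j\cup\{k\}$. **Ideal functionality.** With probability $\delta_{\rm privacy}$ (independently of $D$), the trusted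 party sends $D$ to the simulator and stops. Otherwise it sets $H_j=\emptyset$ for all $j$, sets all rows of a matrix $\tilde\theta\in\mathbb R^{T\times d}$ to zero, samples $\mathbf Z\in\mathbb R^{T\times d}$ with independent $\mathcal N(0,\sigma^2)$ entries, and runs iterations $i=1,\dots,T$. In iteration $i$ it receives from the simulator a cohort $C_{\rm cohort}\subseteq[n]$, an index $k\in[T]$, a model $\vartheta\in\mathbb R^d$ and, for any of the corrupted clients, replacement vectors in $\mathbb R^d$. The input is valid if $C_{\rm cohort}\subseteq f_{\rm qualify}(\Pi,H,k)$ and $k$ has not been used in an earlier iteration; on an invalid input the party waits for another input for the same iteration (if no valid one ever comes, nothing more is sent). On a valid input it adds $k$ to $H_j$ for $j\in C_{\rm cohort}$, sets $g_j=\mathrm{clip}(\nabla_\theta\mathrm{loss}_k(X_j,\vartheta),\zeta)$ for $j\in C_{\rm cohort}$ (with $g_j=0$ if $X_j=\bot$), replaces $g_j$ by the vector received from the simulator, if any, for $j\in C_{\rm cohort}\cap C_{\rm corrupted}$, sets row $k$ of $\tilde\theta$ to $$\tilde\theta_k=\sum_{j\in C_{\rm cohort}}g_j+\zeta\,(\mathbf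 C^{-1}\mathbf Z)[k,:],$$ and sends the rows $\tilde\theta_{1:i}$ to the simulator. A simulator is any randomized algorithm that chooses its inputs (measurably) from its coins, which are independent of the trusted party's randomness, the messages received so far and the number of inputs rejected in the current iteration. Its view is the sequence of messages it receives. It is *standard* (original DP-FTRL) for given losses if in every iteration $i$ of every execution its input is $k=i$, some cohort $C_{\rm cohort}\subseteq f_{\rm qualify}(\Pi,H,i)$ (chosen freely), $\vartheta=\tilde\theta_{i-1}$ (with $\tilde\theta_0:=\theta_0$), and no replacement of gradients. The view satisfies $(\varepsilon,\delta')$-DP if $\Pr[\mathrm{View}(D)\in V]\le e^{\varepsilon}\Pr[\mathrm{View}(D')\in V]+\delta'$ for all adjacent $D,D'$ and all events $V$. **Theorem 1.** Let $\varepsilon,\delta\ge0$. Suppose that original DP-FTRL with the parameters above satisfies $(\varepsilon,\delta+\delta_{\rm privacy})$-DP whatever the training losses are, i.e. for all losses on $\mathcal X$ as above, the view of every simulator that is standard for these losses satisfies $(\varepsilon,\delta+\delta_{\rm privacy})$-DP. Then, for all losses on $\mathcal X$ as above, the view of every simulator (with arbitrary adaptive $k$, $C_{\rm cohort}$, $\vartheta$,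 and arbitrary replacement of corrupted clients' gradients) satisfies $(\varepsilon,\delta+\delta_{\rm privacy})$-DP. -/

import Mathlib

open MeasureTheory ProbabilityTheory
open scoped ENNReal NNReal

universe u v

noncomputable section

namespace IdealFTRL

/-! ### Participation schemas -/

/-- A participation history: for each client, the set of rounds it has participated in. -/
abbrev History (n T : ℕ) := Fin n → Finset (Fin T)

/-- A history adheres to the schema `Π` if every client's record is contained in some pattern
of `Π`. -/
def Adheres {n T : ℕ} (Pi : Set (Finset (Fin T))) (H : History n T) : Prop :=
  ∀ j, ∃ π ∈ Pi, H j ⊆ π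

/-- Updating a history with a cohort and a round index. -/
def History.update {n T : ℕ} (H : History n T) (cohort : Finset (Fin n)) (k : Fin T) :
    History n T :=
  fun j => if j ∈ cohort then insert k (H j) else H j

open Classical in
/-- The clients that may still take part in round `k`: those whose record, extended by `k`, is
contained in some pattern of the schema. -/
def fQualify {n T : ℕ} (Pi : Set (Finset (Fin T))) (H : History n T) (k : Fin T) :
    Finset (Fin n) :=
  Finset.univ.filter fun j => ∃ π ∈ Pi, insert k (H j) ⊆ π

/-- `fQualify` is the largest set with which the history can be updated without violating the
schema. -/
theorem adheres_update_iff {n T : ℕ} {Pi : Set (Finset (Fin T))} {H : History n T}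
    (hH : Adheres Pi H) (cohort : Finset (Fin n)) (k : Fin T) :
    Adheres Pi (H.update cohort k) ↔ cohort ⊆ fQualify Pi H k := by
  constructor
  · intro h j hj
    have := h j
    simp only [History.update, hj, if_true] at this
    simpa [fQualify] using this
  · intro h j
    by_cases hj : j ∈ cohort
    · have := h hj
      simp only [History.update, hj, if_true]
      simpa [fQualify] using this
    · simpa only [History.update, hj, if_false] using hH j

/-! ### Parameters, data, messages -/

/-- Model parameters and gradients, with the Euclidean norm. -/
abbrev Model (d : ℕ) := EuclideanSpace ℝ (Fin d)

/-- A `T × d` matrix given by its rows. -/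
abbrev Rows (T d : ℕ) := Fin T → Model d

/-- The public parameters of the functionality: participation schema, matrix `C`, clipping bound
`ζ`, noise scale `σ`, corrupted clients, initial model. -/
structure Params (n T d : ℕ) where
  schema : Set (Finset (Fin T))
  C : Matrix (Fin T) (Fin T) ℝ
  ζ : ℝ
  σ : ℝ
  corrupted : Finset (Fin n)
  θ₀ : Model d

/-- One record per client; `none` stands for the record of a client that does not participate,
whose contribution is the zero vector. -/
def Dataset (n : ℕ) (X : Type*) := Fin n → Option X

/-- Every set of data sets is an event. -/
instance {n : ℕ} {X : Type*} : MeasurableSpace (Dataset n X) := ⊤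

/-- Zero-out adjacency: the true record of one client is present in one of the data sets and is
zeroed out in the other one; all other clients have the same records. -/
def Adjacent {n : ℕ} {X : Type*} (D D' : Dataset n X) : Prop :=
  ∃ j, (∀ i, i ≠ j → D i = D' i) ∧ ((D j ≠ none ∧ D' j = none) ∨ (D j = none ∧ D' j ≠ none))

/-- A sequence of messages received from the functionality; each message is a matrix. -/
abbrev Transcript (T d : ℕ) := Σ t : ℕ, (Fin t → Rows T d)

/-- What a simulator receives: either the leaked data set or a sequence of messages. -/
abbrev View (n T d : ℕ) (X : Type*) := Dataset n X ⊕ Transcript T d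

/-- The input of the simulator in one iteration. For a corrupted client `j`, `g j = some v` means
that the gradient of `j` is replaced by `v`, and `g j = none` that the corrupted client `j` uses
its honest gradient. -/
structure Request (n T d : ℕ) where
  cohort : Finset (Fin n)
  k : Fin T
  θ : Model d
  g : Fin n → Option (Model d)

/-- A simulator: a randomized interactive algorithm. Given its coins and the messages received so
far, `request ω h m` is its input for the current iteration after `m` invalid inputs in this
iteration. -/
structure Simulator (n T d : ℕ) where
  Coins : Type u
  [mCoins : MeasurableSpace Coins]
  law : Measure Coins
  [isProb : IsProbabilityMeasure law]
  request : Coins → Transcript T d → ℕ → Request n T d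
  measurable_cohort : ∀ m, Measurable fun p : Coins × Transcript T d => (request p.1 p.2 m).cohort
  measurable_k : ∀ m, Measurable fun p : Coins × Transcript T d => (request p.1 p.2 m).k
  measurable_θ : ∀ m, Measurable fun p : Coins × Transcript T d => (request p.1 p.2 m).θ
  measurableSet_g : ∀ m j,
    MeasurableSet {p : Coins × Transcript T d | (request p.1 p.2 m).g j = none}
  measurable_g : ∀ m j,
    Measurable fun p : Coins × Transcript T d => ((request p.1 p.2 m).g j).getD 0

attribute [instance] Simulator.mCoins Simulator.isProb

/-! ### The ideal functionality -/

/-- `clip(v, ζ) = min(1, ζ / ‖v‖) v`. -/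
def clip {d : ℕ} (ζ : ℝ) (v : Model d) : Model d := min 1 (ζ / ‖v‖) • v

/-- The contribution of a client with the given record, for the training loss of one round: the
clipped gradient at `θ`, or the zero vector for a client whose participation is zeroed out. -/
def honestGradient {d : ℕ} {X : Type*} (ζ : ℝ) (loss : X → Model d → ℝ) (x : Option X)
    (θ : Model d) : Model d :=
  match x with
  | none => 0
  | some x => clip ζ (gradient (loss x) θ)

/-- The state of the trusted party: participation history, completed round indices, the matrix
`θ̃`, and the messages sent so far. -/
structure State (n T d : ℕ) where
  H : History n T
  used : Finset (Fin T)
  θ : Rows T d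
  sent : Transcript T d

/-- Initially the history is empty and the matrix is zero. -/
def State.init (n T d : ℕ) : State n T d :=
  ⟨fun _ => ∅, ∅, fun _ => 0, ⟨0, Fin.elim0⟩⟩

section Functionality

variable {n T d : ℕ} {X : Type*}

/-- An input is valid if the cohort is qualified for round `k` and `k` is not completed yet. -/
def Valid (P : Params n T d) (st : State n T d) (r : Request n T d) : Prop :=
  r.cohort ⊆ fQualify P.schema st.H r.k ∧ r.k ∉ st.used

/-- The gradient of client `j` used by the trusted party. The training loss `loss k` may depend on
the round `k`; a round-independent loss is a constant family. -/
def contribution (P : Params n T d) (loss : Fin T → X → Model d → ℝ) (D : Dataset n X)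
    (r : Request n T d) (j : Fin n) : Model d :=
  if j ∈ P.corrupted then (r.g j).getD (honestGradient P.ζ (loss r.k) (D j) r.θ)
  else honestGradient P.ζ (loss r.k) (D j) r.θ

/-- `∑_{j ∈ cohort} g_j + ζ (C⁻¹ Z)[k, :]`. -/
def aggregate (P : Params n T d) (loss : Fin T → X → Model d → ℝ) (D : Dataset n X)
    (Z : Matrix (Fin T) (Fin d) ℝ) (r : Request n T d) : Model d :=
  ∑ j ∈ r.cohort, contribution P loss D r j + P.ζ • WithLp.toLp 2 ((P.C⁻¹ * Z) r.k)

/-- The rows with (zero-based) index at most `i` of a matrix; the other rows are filled with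
zeros. -/
def prefixRows (i : ℕ) (θ : Rows T d) : Rows T d := fun l => if (l : ℕ) ≤ i then θ l else 0

/-- Processing a valid input: the history and the row `k` are updated, and in the (zero-based)
iteration `i` the rows up to `i` are sent. The iteration number is the number of messages already
sent. -/
def process (P : Params n T d) (loss : Fin T → X → Model d → ℝ) (D : Dataset n X)
    (Z : Matrix (Fin T) (Fin d) ℝ) (st : State n T d) (r : Request n T d) : State n T d :=
  let θ' := Function.update st.θ r.k (aggregate P loss D Z r)
  { H := st.H.update r.cohort r.k
    used := insert r.k st.used
    θ := θ'
    sent := ⟨st.sent.1 + 1, Fin.snoc st.sent.2 (prefixRows st.sent.1 θ')⟩ }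

open Classical in
/-- One iteration: the trusted party asks for inputs until it gets a valid one, and processes it.
If the simulator never provides a valid input, nothing is sent any more. -/
def step (P : Params n T d) (loss : Fin T → X → Model d → ℝ) (D : Dataset n X)
    (S : Simulator n T d) (ω : S.Coins) (Z : Matrix (Fin T) (Fin d) ℝ) (st : State n T d) :
    State n T d :=
  if h : ∃ m, Valid P st (S.request ω st.sent m) then
    process P loss D Z st (S.request ω st.sent (Nat.find h))
  else st

/-- The state after `t` iterations. -/
def stateAfter (P : Params n T d) (loss : Fin T → X → Model d → ℝ) (D : Dataset n X)
    (S : Simulator n T d) (ω : S.Coins) (Z : Matrix (Fin T) (Fin d) ℝ) (t : ℕ) : State n T d :=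
  (step P loss D S ω Z)^[t] (State.init n T d)

/-- The law of the noise matrix: independent `N(0, σ²)` entries. -/
def noiseLaw (T d : ℕ) (σ : ℝ) : Measure (Fin T → Fin d → ℝ) :=
  Measure.pi fun _ => Measure.pi fun _ => gaussianReal 0 (Real.toNNReal (σ ^ 2))

open Classical in
/-- The probability that the view of the simulator lies in `V`: with probability `δp` the view is
the data set, otherwise it consists of the messages received in the `T` iterations. -/
def viewProb (P : Params n T d) (δp : ℝ) (loss : Fin T → X → Model d → ℝ) (S : Simulator n T d)
    (D : Dataset n X) (V : Set (View n T d X)) : ℝ≥0∞ :=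
  ENNReal.ofReal δp * (if Sum.inl D ∈ V then 1 else 0) +
    ENNReal.ofReal (1 - δp) * (S.law.prod (noiseLaw T d P.σ))
      {p | Sum.inr (stateAfter P loss D S p.1 (Matrix.of p.2) T).sent ∈ V}

/-- The view of the simulator satisfies `(ε, δ)`-differential privacy. -/
def ViewIsDP (P : Params n T d) (δp : ℝ) (loss : Fin T → X → Model d → ℝ) (S : Simulator n T d)
    (ε δ : ℝ) : Prop :=
  ∀ D D' : Dataset n X, Adjacent D D' → ∀ V : Set (View n T d X), MeasurableSet V →
    viewProb P δp loss S D V ≤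
      ENNReal.ofReal (Real.exp ε) * viewProb P δp loss S D' V + ENNReal.ofReal δ

/-- The model `θ̃_{t-1}` at which standard DP-FTRL evaluates the gradients in the (zero-based)
iteration `t`: the initial model if `t = 0`, and the previous row of `θ̃` otherwise. -/
def previousModel (P : Params n T d) (st : State n T d) (t : Fin T) : Model d :=
  if (t : ℕ) = 0 then P.θ₀ else st.θ ⟨(t : ℕ) - 1, lt_of_le_of_lt (Nat.sub_le _ _) t.isLt⟩

/-- The simulator behaves as standard DP-FTRL: in every iteration of every execution its input is
`k = i`, a cohort inside `fQualify`, the previous model, and no modified gradients. The choice of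
the cohort is otherwise free, and may depend on the coins and on the messages received. -/
def IsStandard (P : Params n T d) (loss : Fin T → X → Model d → ℝ) (S : Simulator n T d) : Prop :=
  ∀ (D : Dataset n X) (ω : S.Coins) (Z : Matrix (Fin T) (Fin d) ℝ) (t : Fin T),
    let st := stateAfter P loss D S ω Z t
    let r := S.request ω st.sent 0
    r.k = t ∧ r.cohort ⊆ fQualify P.schema st.H t ∧ r.θ = previousModel P st t ∧
      ∀ j, r.g j = none

end Functionality

end IdealFTRL

end

noncomputable section

namespace IdealFTRL

/-! ### Densities of product measures -/

/-! Fix the coins and put `W = C⁻¹ Z`. The execution on `D` with noise `Z` has the same states as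
the execution on `D'` with noise `Z + s(Z)`, where `s(Z) = ζ⁻¹ C · shift` and row `k` of `shift` is
the difference of the two sums of gradients in round `k` (`stateAfter_eq_of_shift`). The shift is
adaptive, so it is a function of the noise and not a fixed matrix. Two facts make it no worse than a
fixed one.

The first is volume preservation. The row of `W` translated in an iteration is fresh, and both its
index and the translation depend only on rows used before. Each iteration is thus a shear, and `W ↦
W + c · shift` preserves Lebesgue measure for every real `c` (`measurePreserving_add_shift`);
conjugation with `C` carries this to `Z`.

The second concerns Gaussian measures. If `z ↦ z + c • s z` preserves volume for every `c` and `s`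
has constant length `Δ`, then completing the square gives the moment generating function of `⟨z, s
z⟩`, which is that of a centered normal variable of variance `vΔ²`. The privacy loss then has the
same law as for a constant shift of length `Δ`, and so the same hockey-stick bound holds
(`HasGaussianDensity.measure_preimage_le`). If only `‖s z‖ ≤ Δ`, an independent normal coordinate
absorbs the missing length (`HasGaussianDensity.measure_preimage_le_of_le`).

Every shift comes from one client: its rows have norm at most `ζ` and are supported in a pattern of
the schema (`shift_mem_admissible`). Let `v` maximize the length of `ζ⁻¹ C v` over the compact set
of such matrices. Standard DP-FTRL with linear losses of gradients `v k` and a single participating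
client realizes exactly this constant shift. Its assumed privacy, tested on a likelihood-ratio set,
bounds the hockey-stick divergence at the maximal length by `δ / (1 - δp)` when `δp < 1`
(`measure_preimage_add_le_of_standard`, `HasGaussianDensity.exists_measure_preimage_eq`). This is
what an arbitrary simulator needs; the leak costs the remaining `δp`. -/

theorem lintegral_pi_prod {n : ℕ} {E : Fin n → Type*} {mE : ∀ i, MeasurableSpace (E i)}
    (μ : (i : Fin n) → Measure (E i)) [∀ i, SigmaFinite (μ i)] (f : ∀ i, E i → ℝ≥0∞)
    (hf : ∀ i, Measurable (f i)) :
    ∫⁻ x, ∏ i, f i (x i) ∂(Measure.pi μ) = ∏ i, ∫⁻ x, f i x ∂μ i := by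
  induction n with
  | zero => simp
  | succ n ih =>
    have hm : Measurable fun x : (∀ i : Fin n, E i.succ) => ∏ i : Fin n, f i.succ (x i) :=
      Finset.measurable_prod _ fun i _ => (hf _).comp (measurable_pi_apply i)
    rw [← ((measurePreserving_piFinSuccAbove μ 0).symm).lintegral_comp_emb
      (MeasurableEquiv.measurableEmbedding _)]
    have : ∀ x : E 0 × ((i : Fin n) → E (Fin.succ i)),
        ∏ i, f i ((MeasurableEquiv.piFinSuccAbove E 0).symm x i)
          = f 0 x.1 * ∏ i : Fin n, f i.succ (x.2 i) := by
      intro x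
      rw [Fin.prod_univ_succ]
      rfl
    calc _ = ∫⁻ x : E 0 × ((i : Fin n) → E (Fin.succ i)),
            f 0 x.1 * ∏ i : Fin n, f (Fin.succ i) (x.2 i)
            ∂((μ 0).prod (Measure.pi (fun i ↦ μ i.succ))) := lintegral_congr this
      _ = _ := by
          rw [lintegral_prod_mul (hf 0).aemeasurable hm.aemeasurable, Fin.prod_univ_succ,
            ih _ _ fun i => hf _]

theorem pi_withDensity {n : ℕ} {E : Fin n → Type*} {mE : ∀ i, MeasurableSpace (E i)}
    (μ : (i : Fin n) → Measure (E i)) [∀ i, SigmaFinite (μ i)] (f : ∀ i, E i → ℝ≥0∞)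
    (hf : ∀ i, Measurable (f i)) [∀ i, SigmaFinite ((μ i).withDensity (f i))] :
    Measure.pi (fun i => (μ i).withDensity (f i)) =
      (Measure.pi μ).withDensity fun x => ∏ i, f i (x i) := by
  refine Measure.pi_eq fun s hs => ?_
  rw [withDensity_apply _ (MeasurableSet.univ_pi hs),
    ← lintegral_indicator (MeasurableSet.univ_pi hs)]
  have : ∀ x : (∀ i, E i), (Set.univ.pi s).indicator (fun x => ∏ i, f i (x i)) x =
      ∏ i, (s i).indicator (f i) (x i) := by
    intro x
    by_cases hx : x ∈ Set.univ.pi s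
    · rw [Set.indicator_of_mem hx]
      exact Finset.prod_congr rfl fun i _ => (Set.indicator_of_mem (hx i trivial) _).symm
    · rw [Set.indicator_of_notMem hx]
      simp only [Set.mem_pi, Set.mem_univ, true_implies, not_forall] at hx
      obtain ⟨i, hi⟩ := hx
      exact (Finset.prod_eq_zero (Finset.mem_univ i) (Set.indicator_of_notMem hi _)).symm
  simp_rw [this]
  rw [lintegral_pi_prod _ _ fun i => (hf i).indicator (hs i)]
  exact Finset.prod_congr rfl fun i _ => by
    rw [lintegral_indicator (hs i), withDensity_apply _ (hs i)]

/-! ### Gaussian measures and volume preserving shifts -/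

/-- `γ` has the density `K exp(-B(z, z) / 2v)` with respect to `ν`. -/
structure HasGaussianDensity {E : Type*} [AddCommGroup E] [Module ℝ E] [MeasurableSpace E]
    (B : E →ₗ[ℝ] E →ₗ[ℝ] ℝ) (K v : ℝ) (ν γ : Measure E) : Prop where
  K_nonneg : 0 ≤ K
  v_pos : 0 < v
  symm : ∀ x y, B x y = B y x
  measurable : Measurable fun z => B z z
  eq : γ = ν.withDensity fun z => ENNReal.ofReal (K * Real.exp (-(B z z) / (2 * v)))

/-- The hockey-stick divergence of two normal distributions with variance `v` and distance `Δ`. -/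
def gaussianHockeyStick (v Δ ε : ℝ) : ℝ≥0∞ :=
  ∫⁻ x, ENNReal.ofReal (1 - Real.exp (ε - (x + Δ ^ 2 / 2) / v))
    ∂gaussianReal 0 (Real.toNNReal (v * Δ ^ 2))

section Shift

variable {E : Type*} [AddCommGroup E] [Module ℝ E] [MeasurableSpace E]
  {B : E →ₗ[ℝ] E →ₗ[ℝ] ℝ} {K v : ℝ} {ν γ : Measure E}

theorem HasGaussianDensity.measurable_density (h : HasGaussianDensity B K v ν γ) :
    Measurable fun z => ENNReal.ofReal (K * Real.exp (-(B z z) / (2 * v))) :=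
  (((h.measurable.neg.div_const _).exp).const_mul _).ennreal_ofReal

theorem HasGaussianDensity.density_shift (h : HasGaussianDensity B K v ν γ) {Δ : ℝ} {z s : E}
    (hs : B s s = Δ ^ 2) (c : ℝ) :
    K * Real.exp (-(B (z + c • s) (z + c • s)) / (2 * v)) =
      K * Real.exp (-(B z z) / (2 * v)) * Real.exp (-(c * B z s + c ^ 2 * Δ ^ 2 / 2) / v) := by
  have hv := h.v_pos
  have : B (z + c • s) (z + c • s) = B z z + 2 * c * B z s + c ^ 2 * Δ ^ 2 := by
    simp only [map_add, map_smul, LinearMap.add_apply, LinearMap.smul_apply, smul_eq_mul, hs,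
      h.symm s z]
    ring
  rw [this, mul_assoc K, ← Real.exp_add]
  congr 2
  field_simp
  ring

/-- Completing the square: an exponential tilt by `c * B z (s z)` is, up to a constant factor, the
density evaluated at a shifted point, and the shift does not change integrals against `ν`. All
multiples of `s` must preserve `ν`, since `c` is arbitrary. -/
theorem HasGaussianDensity.lintegral_exp (h : HasGaussianDensity B K v ν γ)
    [IsProbabilityMeasure γ] {s : E → E} {Δ : ℝ} (hΔ : ∀ z, B (s z) (s z) = Δ ^ 2)
    (hm : Measurable fun z => B z (s z))
    (hs : ∀ c : ℝ, MeasurePreserving (fun z => z + c • s z) ν ν) (c : ℝ) :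
    ∫⁻ z, ENNReal.ofReal (Real.exp (c * B z (s z))) ∂γ =
      ENNReal.ofReal (Real.exp (v * Δ ^ 2 * c ^ 2 / 2)) := by
  have hv := h.v_pos
  have h1 : ∫⁻ z, ENNReal.ofReal (K * Real.exp (-(B z z) / (2 * v))) ∂ν = 1 := by
    have := measure_univ (μ := γ)
    rwa [h.eq, withDensity_apply _ MeasurableSet.univ, Measure.restrict_univ] at this
  -- The multiple `-(c * v)` is the one for which the linear term of the density ratio becomes `c *
  -- B z (s z)`.
  have h2 := (hs (-(c * v))).lintegral_comp h.measurable_density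
  have h3 := h.measurable_density.comp (hs (-(c * v))).measurable
  simp only [Function.comp_def] at h3
  have hm' : Measurable fun z => ENNReal.ofReal (Real.exp (c * B z (s z))) :=
    (hm.const_mul c).exp.ennreal_ofReal
  rw [h.eq, lintegral_withDensity_eq_lintegral_mul _ h.measurable_density hm']
  rw [h1] at h2
  rw [← mul_one (ENNReal.ofReal (Real.exp (v * Δ ^ 2 * c ^ 2 / 2))), ← h2,
    ← lintegral_const_mul _ h3]
  refine lintegral_congr fun z => ?_
  rw [Pi.mul_apply, h.density_shift (hΔ z),
    ← ENNReal.ofReal_mul (mul_nonneg h.K_nonneg (Real.exp_nonneg _)),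
    ← ENNReal.ofReal_mul (Real.exp_nonneg _), mul_left_comm, ← Real.exp_add]
  congr 3
  field_simp
  ring

/-- A moment generating function that is finite on the whole line extends analytically to the
complex plane, hence determines the law. -/
theorem map_eq_gaussianReal_of_lintegral_exp {Ω : Type*} [MeasurableSpace Ω] {μ : Measure Ω}
    [IsProbabilityMeasure μ] {Y : Ω → ℝ} (hY : Measurable Y) (w : ℝ≥0)
    (h : ∀ c : ℝ, ∫⁻ z, ENNReal.ofReal (Real.exp (c * Y z)) ∂μ =
      ENNReal.ofReal (Real.exp (w * c ^ 2 / 2))) :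
    μ.map Y = gaussianReal 0 w := by
  have hmgf : mgf Y μ = mgf id (gaussianReal 0 w) := by
    ext c
    rw [mgf_gaussianReal (μ := 0) (v := w) Measure.map_id, mgf, integral_eq_lintegral_of_nonneg_ae
      (Filter.Eventually.of_forall fun _ => Real.exp_nonneg _)
      (hY.const_mul c).exp.aestronglyMeasurable, h c,
      ENNReal.toReal_ofReal (Real.exp_nonneg _), zero_mul, zero_add]
  have huniv : integrableExpSet Y μ = Set.univ := by
    ext c
    simp only [integrableExpSet, Set.mem_ofPred_eq, Set.mem_univ, iff_true]
    refine ⟨(hY.const_mul c).exp.aestronglyMeasurable, ?_⟩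
    rw [hasFiniteIntegral_iff_ofReal (Filter.Eventually.of_forall fun _ => Real.exp_nonneg _), h c]
    exact ENNReal.ofReal_lt_top
  have hc := eqOn_complexMGF_of_mgf hmgf
  rw [huniv, interior_univ] at hc
  simpa using Measure.ext_of_complexMGF_eq hY.aemeasurable aemeasurable_id
    (funext fun z => hc (Set.mem_univ _))

theorem HasGaussianDensity.map_eq (h : HasGaussianDensity B K v ν γ)
    [IsProbabilityMeasure γ] {s : E → E} {Δ : ℝ} (hΔ : ∀ z, B (s z) (s z) = Δ ^ 2)
    (hm : Measurable fun z => B z (s z))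
    (hs : ∀ c : ℝ, MeasurePreserving (fun z => z + c • s z) ν ν) :
    γ.map (fun z => B z (s z)) = gaussianReal 0 (Real.toNNReal (v * Δ ^ 2)) := by
  refine map_eq_gaussianReal_of_lintegral_exp hm _ fun c => ?_
  rw [h.lintegral_exp hΔ hm hs, Real.coe_toNNReal _ (mul_nonneg h.v_pos.le (sq_nonneg _))]

/-! ### Hockey-stick bounds for volume preserving shifts -/

theorem HasGaussianDensity.hockeyStick_eq (h : HasGaussianDensity B K v ν γ)
    [IsProbabilityMeasure γ] {s : E → E} {Δ : ℝ} (hΔ : ∀ z, B (s z) (s z) = Δ ^ 2)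
    (hm : Measurable fun z => B z (s z))
    (hs : ∀ c : ℝ, MeasurePreserving (fun z => z + c • s z) ν ν) (ε : ℝ) :
    gaussianHockeyStick v Δ ε =
      ∫⁻ z, ENNReal.ofReal (1 - Real.exp (ε - (B z (s z) + Δ ^ 2 / 2) / v)) ∂γ := by
  rw [gaussianHockeyStick, ← h.map_eq hΔ hm hs, lintegral_map (by fun_prop) hm]

theorem HasGaussianDensity.measure_eq (h : HasGaussianDensity B K v ν γ)
    {s : E → E} {Δ : ℝ} (hΔ : ∀ z, B (s z) (s z) = Δ ^ 2)
    (hm : Measurable fun z => B z (s z))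
    (hs : MeasurePreserving (fun z => z + s z) ν ν) {A : Set E} (hA : MeasurableSet A) :
    γ A = ∫⁻ z in (fun z => z + s z) ⁻¹' A,
      ENNReal.ofReal (Real.exp (-(B z (s z) + Δ ^ 2 / 2) / v)) ∂γ := by
  have hA' := hs.measurable hA
  have hm' : Measurable fun z => ENNReal.ofReal (Real.exp (-(B z (s z) + Δ ^ 2 / 2) / v)) :=
    ((hm.add_const _).neg.div_const _).exp.ennreal_ofReal
  conv_lhs => rw [h.eq, withDensity_apply _ hA, ← lintegral_indicator hA,
    ← hs.lintegral_comp (h.measurable_density.indicator hA)]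
  rw [← lintegral_indicator hA', h.eq, lintegral_withDensity_eq_lintegral_mul _
    h.measurable_density (hm'.indicator hA')]
  refine lintegral_congr fun z => ?_
  by_cases hz : z + s z ∈ A
  · have := h.density_shift (hΔ z) 1 (z := z)
    simp only [one_smul, one_pow, one_mul] at this
    rw [Set.indicator_of_mem hz, Pi.mul_apply,
      Set.indicator_of_mem (s := (fun z => z + s z) ⁻¹' A) hz, this,
      ENNReal.ofReal_mul (mul_nonneg h.K_nonneg (Real.exp_nonneg _))]
  · rw [Set.indicator_of_notMem hz, Pi.mul_apply,
      Set.indicator_of_notMem (s := (fun z => z + s z) ⁻¹' A) hz, mul_zero]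

theorem HasGaussianDensity.measure_preimage_le (h : HasGaussianDensity B K v ν γ)
    [IsProbabilityMeasure γ] {s : E → E} {Δ : ℝ} (hΔ : ∀ z, B (s z) (s z) = Δ ^ 2)
    (hm : Measurable fun z => B z (s z))
    (hs : ∀ c : ℝ, MeasurePreserving (fun z => z + c • s z) ν ν) (ε : ℝ)
    {A : Set E} (hA : MeasurableSet A) :
    γ ((fun z => z + s z) ⁻¹' A) ≤
      ENNReal.ofReal (Real.exp ε) * γ A + gaussianHockeyStick v Δ ε := by
  have hs1 : MeasurePreserving (fun z => z + s z) ν ν := by simpa using hs 1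
  have hm' : Measurable fun z => ENNReal.ofReal (Real.exp (-(B z (s z) + Δ ^ 2 / 2) / v)) :=
    ((hm.add_const _).neg.div_const _).exp.ennreal_ofReal
  rw [h.measure_eq hΔ hm hs1 hA, h.hockeyStick_eq hΔ hm hs,
    ← lintegral_const_mul _ hm', ← setLIntegral_one]
  -- With privacy loss `ℓ`, the pointwise inequality is `1 ≤ exp (ε - ℓ) + (1 - exp (ε - ℓ))₊`. It
  -- is integrated over the preimage of `A`, after which the last term is enlarged to the whole
  -- space.
  refine le_trans ?_ (add_le_add_right (setLIntegral_le_lintegral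
    ((fun z => z + s z) ⁻¹' A) _) _)
  rw [← lintegral_add_left (hm'.const_mul _)]
  refine lintegral_mono fun z => ?_
  rw [← ENNReal.ofReal_mul (Real.exp_nonneg _), ← Real.exp_add, neg_div, ← sub_eq_add_neg]
  rw [← ENNReal.ofReal_one]
  refine le_trans (ENNReal.ofReal_le_ofReal ?_) ENNReal.ofReal_add_le
  linarith

/-- For a constant shift the bound is sharp, as in the Neyman–Pearson lemma: a threshold set of the
likelihood ratio attains it. -/
theorem HasGaussianDensity.exists_measure_preimage_eq [MeasurableAdd E]
    (h : HasGaussianDensity B K v ν γ)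
    [IsProbabilityMeasure γ] [ν.IsAddRightInvariant] {u : E} {Δ : ℝ} (hΔ : B u u = Δ ^ 2)
    (hm : Measurable fun z => B z u) (ε : ℝ) :
    ∃ A, MeasurableSet A ∧ γ ((fun z => z + u) ⁻¹' A) =
      ENNReal.ofReal (Real.exp ε) * γ A + gaussianHockeyStick v Δ ε := by
  have hs : ∀ c : ℝ, MeasurePreserving (fun z => z + c • u) ν ν := fun c =>
    measurePreserving_add_right ν _
  have hs1 : MeasurePreserving (fun z => z + u) ν ν := measurePreserving_add_right ν _
  -- The quotient is the logarithm of the density of the shifted law relative to `γ`. Pulled back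
  -- along the shift, its numerator becomes `B z u + Δ ^ 2 / 2`, so the preimage is where the
  -- privacy loss is at least `ε`.
  have hA : MeasurableSet {z | ε ≤ (B z u - Δ ^ 2 / 2) / v} :=
    measurableSet_le measurable_const (by fun_prop)
  have hm' : Measurable fun z => ENNReal.ofReal (Real.exp (-(B z u + Δ ^ 2 / 2) / v)) :=
    ((hm.add_const _).neg.div_const _).exp.ennreal_ofReal
  refine ⟨_, hA, ?_⟩
  rw [h.measure_eq (s := fun _ => u) (fun _ => hΔ) hm hs1 hA,
    h.hockeyStick_eq (s := fun _ => u) (fun _ => hΔ) hm hs,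
    ← lintegral_const_mul _ hm', ← setLIntegral_one,
    ← lintegral_add_compl (fun z => ENNReal.ofReal (1 - Real.exp (ε - (B z u + Δ ^ 2 / 2) / v)))
      (hs1.measurable hA), ← add_assoc, ← lintegral_add_left (hm'.const_mul _)]
  -- Off the threshold set the positive part vanishes; on it the positive part equals its argument,
  -- so no inequality is lost.
  rw [setLIntegral_congr_fun (g := fun _ => 0) (hs1.measurable hA).compl, lintegral_zero, add_zero]
  · refine setLIntegral_congr_fun (hs1.measurable hA) fun z hz => ?_
    simp only [Set.mem_preimage, Set.mem_ofPred_eq, map_add, LinearMap.add_apply, hΔ] at hz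
    rw [← ENNReal.ofReal_mul (Real.exp_nonneg _), ← Real.exp_add, neg_div, ← sub_eq_add_neg,
      ← ENNReal.ofReal_add (Real.exp_nonneg _), add_sub_cancel, ENNReal.ofReal_one]
    rw [sub_nonneg, Real.exp_le_one_iff]
    have : B z u + Δ ^ 2 - Δ ^ 2 / 2 = B z u + Δ ^ 2 / 2 := by ring
    rw [this] at hz
    linarith
  · intro z hz
    simp only [Set.mem_compl_iff, Set.mem_preimage, Set.mem_ofPred_eq, map_add, LinearMap.add_apply,
      hΔ, not_le] at hz
    dsimp only
    rw [ENNReal.ofReal_eq_zero, sub_nonpos, Real.one_le_exp_iff]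
    have : B z u + Δ ^ 2 - Δ ^ 2 / 2 = B z u + Δ ^ 2 / 2 := by ring
    rw [this] at hz
    linarith

/-- Adding an independent normal coordinate. -/
theorem HasGaussianDensity.prod [SFinite ν] (h : HasGaussianDensity B K v ν γ) :
    HasGaussianDensity
      (B.compl₁₂ (LinearMap.fst ℝ E ℝ) (LinearMap.fst ℝ E ℝ) +
        (LinearMap.mul ℝ ℝ).compl₁₂ (LinearMap.snd ℝ E ℝ) (LinearMap.snd ℝ E ℝ))
      (K * (√(2 * Real.pi * v))⁻¹) v (ν.prod volume)
      (γ.prod (gaussianReal 0 (Real.toNNReal v))) where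
  K_nonneg := mul_nonneg h.K_nonneg (by positivity)
  v_pos := h.v_pos
  symm x y := by simp [h.symm x.1 y.1, mul_comm]
  measurable := by
    have := h.measurable.comp (measurable_fst : Measurable (Prod.fst : E × ℝ → E))
    simp only [Function.comp_def] at this
    simp only [LinearMap.add_apply, LinearMap.compl₁₂_apply, LinearMap.fst_apply,
      LinearMap.snd_apply, LinearMap.mul_apply']
    exact this.add (measurable_snd.mul measurable_snd)
  eq := by
    have hv : Real.toNNReal v ≠ 0 := by simpa using h.v_pos
    rw [h.eq, gaussianReal_of_var_ne_zero _ hv,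
      prod_withDensity h.measurable_density (measurable_gaussianPDF _ _)]
    congr 1
    ext z
    rw [gaussianPDF, gaussianPDFReal, Real.coe_toNNReal _ h.v_pos.le,
      ← ENNReal.ofReal_mul (mul_nonneg h.K_nonneg (Real.exp_nonneg _))]
    congr 1
    simp only [LinearMap.add_apply, LinearMap.compl₁₂_apply, LinearMap.fst_apply,
      LinearMap.snd_apply, LinearMap.mul_apply', neg_add, add_div, Real.exp_add]
    ring_nf

/-- A volume preserving shift whose length is bounded by that of a constant shift is at most as
distinguishable as the constant shift. -/
theorem HasGaussianDensity.measure_preimage_le_of_le [SFinite ν]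
    (h : HasGaussianDensity B K v ν γ) [IsProbabilityMeasure γ] {s : E → E} {Δ : ℝ}
    (hΔ : ∀ z, B (s z) (s z) ≤ Δ ^ 2)
    (hm : Measurable fun z => B z (s z)) (hm' : Measurable fun z => B (s z) (s z))
    (hs : ∀ c : ℝ, MeasurePreserving (fun z => z + c • s z) ν ν) (ε : ℝ)
    {A : Set E} (hA : MeasurableSet A) :
    γ ((fun z => z + s z) ⁻¹' A) ≤
      ENNReal.ofReal (Real.exp ε) * γ A + gaussianHockeyStick v Δ ε := by
  -- The square root pads the shift to length exactly `Δ`. The padded map is a skew product, so it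
  -- still preserves volume, and `A ×ˢ univ` does not see the extra coordinate.
  have key := h.prod.measure_preimage_le (Δ := Δ)
    (s := fun p => (s p.1, √(Δ ^ 2 - B (s p.1) (s p.1)))) ?_ ?_ ?_ ε
    (A := A ×ˢ Set.univ) (hA.prod MeasurableSet.univ)
  · have h1 : (fun p : E × ℝ => p + (s p.1, √(Δ ^ 2 - B (s p.1) (s p.1)))) ⁻¹' (A ×ˢ Set.univ) =
        ((fun z => z + s z) ⁻¹' A) ×ˢ Set.univ := by
      ext p
      simp
    rwa [h1, Measure.prod_prod, Measure.prod_prod, measure_univ, mul_one, mul_one] at key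
  · intro p
    simp only [LinearMap.add_apply, LinearMap.compl₁₂_apply, LinearMap.fst_apply,
      LinearMap.snd_apply, LinearMap.mul_apply']
    rw [Real.mul_self_sqrt (by linarith [hΔ p.1])]
    ring
  · simp only [LinearMap.add_apply, LinearMap.compl₁₂_apply, LinearMap.fst_apply,
      LinearMap.snd_apply, LinearMap.mul_apply']
    have h1 := hm.comp (measurable_fst : Measurable (Prod.fst : E × ℝ → E))
    have h2 := hm'.comp (measurable_fst : Measurable (Prod.fst : E × ℝ → E))
    simp only [Function.comp_def] at h1 h2
    exact h1.add (measurable_snd.mul (h2.const_sub _).sqrt)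
  · intro c
    have h2 := hm'.comp (measurable_fst : Measurable (Prod.fst : E × ℝ → E))
    simp only [Function.comp_def] at h2
    refine (hs c).skew_product (g := fun z r => r + c • √(Δ ^ 2 - B (s z) (s z))) ?_ ?_
    · simp only [Function.uncurry_def]
      exact measurable_snd.add ((h2.const_sub _).sqrt.const_smul c)
    · exact Filter.Eventually.of_forall fun z => (measurePreserving_add_right volume _).map_eq

end Shift

/-! ### The noise matrix -/

/-- The Frobenius inner product of two matrices. -/
def frobenius (T d : ℕ) : (Fin T → Fin d → ℝ) →ₗ[ℝ] (Fin T → Fin d → ℝ) →ₗ[ℝ] ℝ :=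
  LinearMap.mk₂ ℝ (fun z w => ∑ k, ∑ l, z k l * w k l)
    (fun x y z => by simp [add_mul, Finset.sum_add_distrib])
    (fun c x y => by simp [Finset.mul_sum, mul_assoc])
    (fun x y z => by simp [mul_add, Finset.sum_add_distrib])
    (fun c x y => by simp [Finset.mul_sum, mul_left_comm])

theorem frobenius_apply {T d : ℕ} (z w : Fin T → Fin d → ℝ) :
    frobenius T d z w = ∑ k, ∑ l, z k l * w k l := rfl

theorem measurable_frobenius {α : Type*} [MeasurableSpace α] {T d : ℕ}
    {f g : α → Fin T → Fin d → ℝ} (hf : Measurable f) (hg : Measurable g) :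
    Measurable fun a => frobenius T d (f a) (g a) := by
  simp only [frobenius_apply]
  refine Finset.measurable_sum _ fun k _ => Finset.measurable_sum _ fun l _ => ?_
  exact ((measurable_pi_apply l).comp ((measurable_pi_apply k).comp hf)).mul
    ((measurable_pi_apply l).comp ((measurable_pi_apply k).comp hg))

instance (T d : ℕ) (σ : ℝ) : IsProbabilityMeasure (noiseLaw T d σ) := by
  unfold noiseLaw; infer_instance

theorem hasGaussianDensity_noiseLaw (T d : ℕ) {σ : ℝ} (hσ : 0 < σ) :
    HasGaussianDensity (frobenius T d) (∏ _k : Fin T, ∏ _l : Fin d, (√(2 * Real.pi * σ ^ 2))⁻¹)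
      (σ ^ 2) volume (noiseLaw T d σ) where
  K_nonneg := by positivity
  v_pos := by positivity
  symm x y := by simp [frobenius_apply, mul_comm]
  measurable := measurable_frobenius measurable_id measurable_id
  eq := by
    have hv : Real.toNNReal (σ ^ 2) ≠ 0 := by simpa using hσ.ne'
    have hg : ∀ μ : ℝ, volume.withDensity (gaussianPDF μ (Real.toNNReal (σ ^ 2))) =
      gaussianReal μ (Real.toNNReal (σ ^ 2)) := fun μ => (gaussianReal_of_var_ne_zero _ hv).symm
    have : SigmaFinite (volume.withDensity (gaussianPDF 0 (Real.toNNReal (σ ^ 2)))) := by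
      rw [hg]; infer_instance
    have h1 : Measure.pi (fun _ : Fin d => gaussianReal 0 (Real.toNNReal (σ ^ 2))) =
        volume.withDensity fun z => ∏ l, gaussianPDF 0 (Real.toNNReal (σ ^ 2)) (z l) := by
      rw [← hg, pi_withDensity _ _ fun _ => measurable_gaussianPDF _ _, volume_pi]
    have : SigmaFinite (volume.withDensity fun z : Fin d → ℝ =>
        ∏ l, gaussianPDF 0 (Real.toNNReal (σ ^ 2)) (z l)) := by
      rw [← h1]; infer_instance
    rw [noiseLaw, h1, pi_withDensity, volume_pi]
    · congr 1
      ext z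
      simp only [gaussianPDF, gaussianPDFReal, Real.coe_toNNReal _ (sq_nonneg σ), sub_zero]
      rw [frobenius_apply, neg_div, Finset.sum_div, ← Finset.sum_neg_distrib, Real.exp_sum,
        ← Finset.prod_mul_distrib, ENNReal.ofReal_prod_of_nonneg fun _ _ => by positivity]
      refine Finset.prod_congr rfl fun k _ => ?_
      rw [Finset.sum_div, ← Finset.sum_neg_distrib, Real.exp_sum,
        ← Finset.prod_mul_distrib, ENNReal.ofReal_prod_of_nonneg fun _ _ => by positivity]
      refine Finset.prod_congr rfl fun l _ => ?_
      rw [neg_div, pow_two (z k l)]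
    · intro k
      exact Finset.measurable_prod _ fun l _ =>
        (measurable_gaussianPDF _ _).comp (measurable_pi_apply l)

/-! ### Adaptive shears preserve the volume -/

section Shear

variable {ι V : Type*} [Fintype ι] [DecidableEq ι] [AddCommGroup V] [MeasurableSpace V]
  [MeasurableAdd₂ V] (ν : Measure V) [SigmaFinite ν] [ν.IsAddRightInvariant]

/-- Translating one coordinate by a function of the other ones preserves a product measure. -/
theorem measurePreserving_update_add (κ : ι) {g : (ι → V) → V} (hg : Measurable g)
    (hκ : ∀ W v, g (Function.update W κ v) = g W) :
    MeasurePreserving (fun W => Function.update W κ (W κ + g W))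
      (Measure.pi fun _ => ν) (Measure.pi fun _ => ν) := by
  have hm : Measurable fun W : ι → V => Function.update W κ (W κ + g W) := by
    refine measurable_pi_iff.2 fun i => ?_
    by_cases hi : i = κ
    · subst hi
      simp only [Function.update_self]
      exact (measurable_pi_apply i).add hg
    · simp only [Function.update_of_ne hi]
      exact measurable_pi_apply i
  refine ⟨hm, Measure.ext fun A hA => ?_⟩
  rw [Measure.map_apply hm hA, ← lintegral_indicator_one hA, ← lintegral_indicator_one (hm hA)]
  set f : (ι → V) → ℝ≥0∞ := A.indicator 1 with hf
  have hfm : Measurable f := measurable_one.indicator hA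
  have h1 : ((fun W => Function.update W κ (W κ + g W)) ⁻¹' A).indicator 1 =
    fun W => f (Function.update W κ (W κ + g W)) := rfl
  have hfm' : Measurable fun W => f (Function.update W κ (W κ + g W)) := hfm.comp hm
  -- Coordinate `κ` is integrated first; with the other coordinates fixed, `g` is constant and the
  -- inner integral is translation invariant.
  rw [h1, lintegral_eq_lmarginal_univ (fun _ => 0), lintegral_eq_lmarginal_univ (fun _ => 0),
    lmarginal_erase' _ hfm' (Finset.mem_univ κ),
    lmarginal_erase' _ hfm (Finset.mem_univ κ)]
  congr 1
  ext W
  simp only [Function.update_idem, Function.update_self, hκ]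
  exact lintegral_add_right_eq_self (fun v => f (Function.update W κ v)) (g W)

/-- Translating an adaptively chosen coordinate by a vector, where both the choice and the vector
do not depend on the chosen coordinate, preserves a product measure. -/
theorem measurePreserving_adaptive_add (k : (ι → V) → Option ι)
    (hk : ∀ o, MeasurableSet {W | k W = o})
    {f : (ι → V) → ι → V} (hf : Measurable f) (h0 : ∀ W i, k W ≠ some i → f W i = 0)
    (hinv : ∀ W i v, k W = some i → k (Function.update W i v) = some i ∧
      f (Function.update W i v) = f W) :
    MeasurePreserving (fun W => W + f W) (Measure.pi fun _ => ν) (Measure.pi fun _ => ν) := by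
  have hm : Measurable fun W : ι → V => W + f W := by
    refine measurable_pi_iff.2 fun i => ?_
    exact (measurable_pi_apply i).add ((measurable_pi_apply i).comp hf)
  refine ⟨hm, Measure.ext fun A hA => ?_⟩
  rw [Measure.map_apply hm hA]
  -- The space is split by the chosen coordinate. On each piece the map is a shear of one fixed
  -- coordinate, and it leaves the piece invariant.
  have hdec : ∀ S : Set (ι → V), MeasurableSet S → (Measure.pi fun _ => ν) S =
      ∑ o : Option ι, (Measure.pi fun _ => ν) (S ∩ {W | k W = o}) := by
    intro S hS
    rw [← measure_biUnion_finset]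
    · congr 1
      ext W
      simp
    · intro o _ o' _ hne
      refine Set.disjoint_left.2 fun W hW hW' => hne ?_
      exact hW.2.symm.trans hW'.2
    · exact fun o _ => hS.inter (hk o)
  rw [hdec _ (hm hA), hdec _ hA]
  refine Finset.sum_congr rfl fun o _ => ?_
  rcases o with _ | i
  · congr 1
    ext W
    simp only [Set.mem_inter_iff, Set.mem_preimage, Set.mem_ofPred_eq, and_congr_left_iff]
    intro hW
    have : f W = 0 := funext fun i => h0 W i (by simp [hW])
    rw [this, add_zero]
  · classical
    let g : (ι → V) → V := {W | k W = some i}.indicator fun W => f W i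
    have hg : Measurable g := ((measurable_pi_apply i).comp hf).indicator (hk _)
    have hgi : ∀ W v, g (Function.update W i v) = g W := by
      intro W v
      by_cases hW : k W = some i
      · have := hinv W i v hW
        simp only [g]
        rw [Set.indicator_of_mem (show W ∈ {W | k W = some i} from hW),
          Set.indicator_of_mem (show Function.update W i v ∈ {W | k W = some i} from this.1),
          this.2]
      · have hW' : k (Function.update W i v) ≠ some i := by
          -- Restoring the old value of the coordinate is again an update, so the invariance of the
          -- choice also holds in the converse direction.
          intro h
          have := (hinv _ i (W i) h).1
          rw [Function.update_idem, Function.update_eq_self] at this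
          exact hW this
        simp only [g]
        rw [Set.indicator_of_notMem (show W ∉ {W | k W = some i} from hW),
          Set.indicator_of_notMem (show Function.update W i v ∉ {W | k W = some i} from hW')]
    have hmp := measurePreserving_update_add ν i hg hgi
    rw [← hmp.measure_preimage (hA.inter (hk (some i))).nullMeasurableSet]
    congr 1
    ext W
    simp only [Set.mem_inter_iff, Set.mem_preimage, Set.mem_ofPred_eq]
    by_cases hW : k W = some i
    · have h1 : g W = f W i := Set.indicator_of_mem (show W ∈ {W | k W = some i} from hW) _
      have h2 : Function.update W i (W i + g W) = W + f W := by
        rw [h1]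
        ext j
        by_cases hj : j = i
        · subst hj; simp
        · have : f W j = 0 := h0 W j (by rw [hW]; simpa using fun h => hj h.symm)
          simp [hj, this]
      rw [h2, ← h2, (hinv W i _ hW).1]
      simp [hW]
    · have : k (Function.update W i (W i + g W)) ≠ some i := by
        intro h
        have := (hinv _ i (W i) h).1
        rw [Function.update_idem, Function.update_eq_self] at this
        exact hW this
      simp [hW, this]

end Shear

/-- Conjugating with an invertible linear map preserves the property of preserving the volume. -/
theorem measurePreserving_conj {E : Type*} [NormedAddCommGroup E] [NormedSpace ℝ E]
    [MeasurableSpace E] [BorelSpace E] [FiniteDimensional ℝ E] (μ : Measure E)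
    [μ.IsAddHaarMeasure] (L : E ≃ₗ[ℝ] E) {φ : E → E} (hφ : MeasurePreserving φ μ μ) :
    MeasurePreserving (fun z => L (φ (L.symm z))) μ μ := by
  have hL : Measurable L := L.toLinearMap.continuous_of_finiteDimensional.measurable
  have hL' : Measurable L.symm := L.symm.toLinearMap.continuous_of_finiteDimensional.measurable
  refine ⟨hL.comp (hφ.measurable.comp hL'), ?_⟩
  -- The image of `μ` under `L.symm` is a constant multiple of `μ`, which `φ` also preserves.
  have hdet : LinearMap.det (L.symm : E →ₗ[ℝ] E) ≠ 0 := L.symm.isUnit_det'.ne_zero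
  have h1 := Measure.map_linearMap_addHaar_eq_smul_addHaar μ hdet
  have h2 : Measure.map L (Measure.map L.symm μ) = μ := by
    rw [Measure.map_map hL hL']
    convert Measure.map_id
    ext; simp
  have h3 : Measure.map (fun z => L (φ (L.symm z))) μ =
      Measure.map L (Measure.map φ (Measure.map L.symm μ)) := by
    rw [Measure.map_map hφ.measurable hL', Measure.map_map hL (hφ.measurable.comp hL')]
    rfl
  rw [h3]
  conv_rhs => rw [← h2]
  congr 1
  change Measure.map φ (Measure.map (L.symm : E →ₗ[ℝ] E) μ) = Measure.map (L.symm : E →ₗ[ℝ] E) μ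
  rw [h1, Measure.map_smul, hφ.map_eq]

instance (T d : ℕ) : (volume : Measure (Fin T → Fin d → ℝ)).IsAddHaarMeasure where

/-! ### Measurability of the execution -/

/-- The message number `l` of a transcript, or zero if there is none. -/
def message {T d : ℕ} (h : Transcript T d) (l : ℕ) : Rows T d :=
  if hl : l < h.1 then h.2 ⟨l, hl⟩ else 0

theorem measurable_length {T d : ℕ} : Measurable fun h : Transcript T d => h.1 := by
  intro A _
  refine MeasurableSpace.measurableSet_iInf.2 fun t => ?_
  change MeasurableSet {_x : Fin t → Rows T d | t ∈ A}
  exact MeasurableSet.const _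

theorem measurable_message {T d : ℕ} (l : ℕ) :
    Measurable fun h : Transcript T d => message h l := by
  intro A hA
  refine MeasurableSpace.measurableSet_iInf.2 fun t => ?_
  change MeasurableSet {x : Fin t → Rows T d | message ⟨t, x⟩ l ∈ A}
  by_cases hl : l < t
  · simp only [message, hl, dif_pos]
    exact (measurable_pi_apply (⟨l, hl⟩ : Fin t) : Measurable fun x : Fin t → Rows T d => _) hA
  · simp only [message, hl, dif_neg, not_false_eq_true]
    exact MeasurableSet.const _

/-- A transcript is determined by its length and its messages, and splitting by length leaves finite
products. -/
theorem measurable_of_message {α : Type*} [MeasurableSpace α] {T d : ℕ} {f : α → Transcript T d}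
    (h1 : Measurable fun a => (f a).1) (h2 : ∀ l, Measurable fun a => message (f a) l) :
    Measurable f := by
  intro A hA
  have hA' := MeasurableSpace.measurableSet_iInf.1 hA
  have : f ⁻¹' A = ⋃ t : ℕ, {a | (f a).1 = t} ∩
      {a | (fun l : Fin t => message (f a) l) ∈ Sigma.mk t ⁻¹' A} := by
    ext a
    simp only [Set.mem_preimage, Set.mem_iUnion, Set.mem_inter_iff, Set.mem_ofPred_eq]
    have : (⟨(f a).1, fun l : Fin (f a).1 => message (f a) l⟩ : Transcript T d) = f a := by
      obtain ⟨t, x⟩ := f a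
      simp [message]
    constructor
    · exact fun h => ⟨_, rfl, by rwa [this]⟩
    · rintro ⟨t, rfl, h⟩
      rwa [this] at h
  rw [this]
  refine MeasurableSet.iUnion fun t => (h1 (MeasurableSet.of_discrete (s := {t}))).inter ?_
  exact measurable_pi_iff.2 (fun l : Fin t => h2 l) (hA' t)

theorem message_snoc {T d : ℕ} (h : Transcript T d) (M : Rows T d) (l : ℕ) :
    message ⟨h.1 + 1, Fin.snoc h.2 M⟩ l = if l = h.1 then M else message h l := by
  obtain ⟨t, x⟩ := h
  simp only [message, Fin.snoc]
  split_ifs <;> first | omega | rfl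

variable {n T d : ℕ} {X : Type u}

/-- A measurable family of states. -/
structure MeasurableState {α : Type*} [MeasurableSpace α] (f : α → State n T d) : Prop where
  H : Measurable fun a => (f a).H
  used : Measurable fun a => (f a).used
  θ : Measurable fun a => (f a).θ
  sent : Measurable fun a => (f a).sent

/-- A measurable family of requests. -/
structure MeasurableRequest {α : Type*} [MeasurableSpace α] (r : α → Request n T d) : Prop where
  cohort : Measurable fun a => (r a).cohort
  k : Measurable fun a => (r a).k
  θ : Measurable fun a => (r a).θ
  set_g : ∀ j, MeasurableSet {a | (r a).g j = none}
  g : ∀ j, Measurable fun a => ((r a).g j).getD 0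

theorem measurable_clip (ζ : ℝ) : Measurable (clip (d := d) ζ) := by
  unfold clip
  exact (measurable_const.min (measurable_const.div measurable_norm)).smul measurable_id

theorem measurable_honestGradient (ζ : ℝ) (loss : X → Model d → ℝ) (x : Option X) :
    Measurable (honestGradient ζ loss x) := by
  rcases x with _ | x
  · exact measurable_const
  · have h : Continuous (InnerProductSpace.toDual ℝ (Model d)).symm :=
      LinearIsometryEquiv.continuous _
    have h1 : Measurable (fderiv ℝ (loss x)) := measurable_fderiv ℝ (loss x)
    have h2 : Measurable fun θ => (InnerProductSpace.toDual ℝ (Model d)).symm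
        (fderiv ℝ (loss x) θ) := h.measurable.comp h1
    exact (measurable_clip ζ).comp h2

section

variable {α : Type*} [MeasurableSpace α]

theorem measurable_apply_countable {κ β γ : Type*} [MeasurableSpace κ] [Countable κ]
    [MeasurableSingletonClass κ] [MeasurableSpace β] [MeasurableSpace γ] {g : κ → β → γ}
    (hg : ∀ k, Measurable (g k)) {k : α → κ} (hk : Measurable k) {b : α → β}
    (hb : Measurable b) : Measurable fun a => g (k a) (b a) :=
  (measurable_from_prod_countable_right (f := fun p : κ × β => g p.1 p.2) hg).comp (hk.prodMk hb)

theorem MeasurableRequest.contribution (P : Params n T d) (loss : Fin T → X → Model d → ℝ)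
    (D : Dataset n X) {r : α → Request n T d} (hr : MeasurableRequest r) (j : Fin n) :
    Measurable fun a => contribution P loss D (r a) j := by
  have h1 : ∀ k : Fin T, Measurable (honestGradient P.ζ (loss k) (D j)) := fun k =>
    measurable_honestGradient P.ζ (loss k) (D j)
  have h2 : Measurable fun a => honestGradient P.ζ (loss (r a).k) (D j) (r a).θ :=
    measurable_apply_countable h1 hr.k hr.θ
  by_cases hj : j ∈ P.corrupted
  · have h4 : (fun a => IdealFTRL.contribution P loss D (r a) j) = fun a =>
        @ite _ ((r a).g j = none) (Classical.propDecidable _)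
          (honestGradient P.ζ (loss (r a).k) (D j) (r a).θ) (((r a).g j).getD 0) := by
      funext a
      rw [IdealFTRL.contribution, if_pos hj]
      cases (r a).g j <;> simp
    rw [h4]
    exact Measurable.ite (hr.set_g j) h2 (hr.g j)
  · have h4 : (fun a => IdealFTRL.contribution P loss D (r a) j) = fun a =>
        honestGradient P.ζ (loss (r a).k) (D j) (r a).θ := by
      funext a
      rw [IdealFTRL.contribution, if_neg hj]
    rw [h4]
    exact h2

theorem MeasurableRequest.sum_cohort {β : Type*} [AddCommMonoid β] [MeasurableSpace β]
    [MeasurableAdd₂ β] {r : α → Request n T d} (hr : MeasurableRequest r) {c : α → Fin n → β}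
    (hc : ∀ j, Measurable fun a => c a j) :
    Measurable fun a => ∑ j ∈ (r a).cohort, c a j := by
  have : ∀ a, ∑ j ∈ (r a).cohort, c a j = ∑ j, if j ∈ (r a).cohort then c a j else 0 := by
    intro a
    simp
  simp only [this]
  refine Finset.measurable_sum _ fun j _ => Measurable.ite ?_ (hc j) measurable_const
  exact hr.cohort (MeasurableSet.of_discrete (s := {s | j ∈ s}))

theorem measurable_inv_mul (P : Params n T d) :
    Measurable fun (Z : Fin T → Fin d → ℝ) (k : Fin T) (l : Fin d) =>
      (P.C⁻¹ * Matrix.of Z) k l := by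
  refine measurable_pi_iff.2 fun k => measurable_pi_iff.2 fun l => ?_
  have h : Measurable fun Z : Fin T → Fin d → ℝ => ∑ i, P.C⁻¹ k i * Z i l :=
    Finset.measurable_sum _ fun i _ =>
      ((measurable_pi_apply l : Measurable fun z : Fin d → ℝ => z l).comp
        (measurable_pi_apply i : Measurable fun Z : Fin T → Fin d → ℝ => Z i)).const_mul _
  exact h

theorem MeasurableRequest.aggregate (P : Params n T d) (loss : Fin T → X → Model d → ℝ)
    (D : Dataset n X) {r : α → Request n T d} (hr : MeasurableRequest r)
    {Z : α → Fin T → Fin d → ℝ} (hZ : Measurable Z) :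
    Measurable fun a => aggregate P loss D (Matrix.of (Z a)) (r a) := by
  have h1 : Measurable fun p : Fin T × (Fin T → Fin d → ℝ) => p.2 p.1 :=
    measurable_from_prod_countable_right fun k => measurable_pi_apply k
  have h2 := h1.comp (hr.k.prodMk ((measurable_inv_mul P).comp hZ))
  have h3 : Measurable fun a => WithLp.toLp 2 ((P.C⁻¹ * Matrix.of (Z a)) (r a).k) :=
    (WithLp.measurable_toLp 2 _).comp h2
  exact (hr.sum_cohort fun j => hr.contribution P loss D j).add (h3.const_smul P.ζ)

theorem MeasurableState.process (P : Params n T d) (loss : Fin T → X → Model d → ℝ)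
    (D : Dataset n X) {r : α → Request n T d} (hr : MeasurableRequest r)
    {Z : α → Fin T → Fin d → ℝ} (hZ : Measurable Z) {f : α → State n T d}
    (hf : MeasurableState f) :
    MeasurableState fun a => process P loss D (Matrix.of (Z a)) (f a) (r a) := by
  have hθ : Measurable fun a => (IdealFTRL.process P loss D (Matrix.of (Z a)) (f a) (r a)).θ := by
    refine measurable_pi_iff.2 fun k => ?_
    simp only [IdealFTRL.process, Function.update_apply]
    refine Measurable.ite ?_ (hr.aggregate P loss D hZ) ((measurable_pi_apply k).comp hf.θ)
    exact hr.k (MeasurableSet.of_discrete (s := {i | k = i}))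
  have hl : Measurable fun a => (f a).sent.1 := measurable_length.comp hf.sent
  refine ⟨?_, ?_, hθ, ?_⟩
  · exact (Measurable.of_discrete (f := fun p : (History n T × Finset (Fin n)) × Fin T =>
      p.1.1.update p.1.2 p.2)).comp ((hf.H.prodMk hr.cohort).prodMk hr.k)
  · exact (Measurable.of_discrete (f := fun p : Fin T × Finset (Fin T) => insert p.1 p.2)).comp
      (hr.k.prodMk hf.used)
  · refine measurable_of_message ?_ fun l => ?_
    · exact (Measurable.of_discrete (f := fun t : ℕ => t + 1)).comp hl
    · simp only [IdealFTRL.process, message_snoc]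
      refine Measurable.ite (hl (MeasurableSet.of_discrete (s := {i | l = i}))) ?_
        ((measurable_message l).comp hf.sent)
      refine measurable_pi_iff.2 fun k => ?_
      refine Measurable.ite (hl (MeasurableSet.of_discrete (s := {i | (k : ℕ) ≤ i}))) ?_
        measurable_const
      exact (measurable_pi_apply k).comp hθ

/-! ### The first valid input, and measurability of an iteration -/

open Classical in
/-- The first valid input of the simulator in an iteration, if there is one. -/
def accepted (P : Params n T d) (S : Simulator.{v} n T d) (ω : S.Coins) (st : State n T d) :
    Option (Request n T d) :=
  if h : ∃ m, Valid P st (S.request ω st.sent m) then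
    some (S.request ω st.sent (Nat.find h))
  else none

theorem valid_of_accepted {P : Params n T d} {S : Simulator.{v} n T d} {ω : S.Coins}
    {st : State n T d} {r : Request n T d} (h : accepted P S ω st = some r) : Valid P st r := by
  classical
  unfold accepted at h
  split_ifs at h with hm
  rw [← Option.some.inj h]
  convert Nat.find_spec hm

theorem step_of_accepted_none {P : Params n T d} {S : Simulator.{v} n T d} {ω : S.Coins}
    {st : State n T d} (loss : Fin T → X → Model d → ℝ) (D : Dataset n X)
    (Z : Matrix (Fin T) (Fin d) ℝ) (h : accepted P S ω st = none) :
    step P loss D S ω Z st = st := by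
  unfold accepted at h
  unfold step
  split_ifs at h ⊢
  rfl

theorem step_of_accepted_some {P : Params n T d} {S : Simulator.{v} n T d} {ω : S.Coins}
    {st : State n T d} {r : Request n T d} (loss : Fin T → X → Model d → ℝ) (D : Dataset n X)
    (Z : Matrix (Fin T) (Fin d) ℝ) (h : accepted P S ω st = some r) :
    step P loss D S ω Z st = process P loss D Z st r := by
  unfold accepted at h
  unfold step
  split_ifs at h ⊢
  rw [← Option.some.inj h]

/-- `Request` carries no σ-algebra, so measurability of the accepted input is expressed through an
observable `g`. The proof splits into countably many events according to the index of the first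
valid input. -/
theorem measurable_accepted (P : Params n T d) (S : Simulator.{v} n T d) {ω : α → S.Coins}
    (hω : Measurable ω) {f : α → State n T d} (hf : MeasurableState f) {β : Type*}
    [MeasurableSpace β] {g : α → Option (Request n T d) → β} (h0 : Measurable fun a => g a none)
    (hs : ∀ r : α → Request n T d, MeasurableRequest r → Measurable fun a => g a (some (r a))) :
    Measurable fun a => g a (accepted P S (ω a) (f a)) := by
  classical
  have hp := hω.prodMk hf.sent
  have hr : ∀ m, MeasurableRequest fun a => S.request (ω a) (f a).sent m := fun m =>
    { cohort := (S.measurable_cohort m).comp hp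
      k := (S.measurable_k m).comp hp
      θ := (S.measurable_θ m).comp hp
      set_g := fun j => hp (S.measurableSet_g m j)
      g := fun j => (S.measurable_g m j).comp hp }
  have hV : ∀ m, MeasurableSet {a | Valid P (f a) (S.request (ω a) (f a).sent m)} := by
    intro m
    have h1 : Measurable fun a => (((S.request (ω a) (f a).sent m).cohort, (f a).H),
      ((S.request (ω a) (f a).sent m).k, (f a).used)) :=
      ((hr m).cohort.prodMk hf.H).prodMk ((hr m).k.prodMk hf.used)
    exact h1 (MeasurableSet.of_discrete (s := {p | p.1.1 ⊆ fQualify P.schema p.1.2 p.2.1 ∧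
      p.2.1 ∉ p.2.2}))
  intro A hA
  have : (fun a => g a (accepted P S (ω a) (f a))) ⁻¹' A =
      (⋃ m, ({a | Valid P (f a) (S.request (ω a) (f a).sent m)} ∩
        ⋂ i, ⋂ (_ : i < m), {a | Valid P (f a) (S.request (ω a) (f a).sent i)}ᶜ) ∩
        {a | g a (some (S.request (ω a) (f a).sent m)) ∈ A}) ∪
      ((⋂ i, {a | Valid P (f a) (S.request (ω a) (f a).sent i)}ᶜ) ∩ {a | g a none ∈ A}) := by
    ext a
    simp only [Set.mem_preimage, Set.mem_union, Set.mem_iUnion, Set.mem_inter_iff,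
      Set.mem_iInter, Set.mem_compl_iff, Set.mem_ofPred_eq]
    by_cases h : ∃ m, Valid P (f a) (S.request (ω a) (f a).sent m)
    · have hacc : accepted P S (ω a) (f a) = some (S.request (ω a) (f a).sent (Nat.find h)) := by
        unfold accepted
        rw [dif_pos h]
      rw [hacc]
      constructor
      · exact fun hg => Or.inl ⟨_, ⟨Nat.find_spec h, fun i hi => Nat.find_min h hi⟩, hg⟩
      · rintro (⟨m, ⟨h1, h2⟩, hg⟩ | ⟨h1, _⟩)
        · rwa [(Nat.find_eq_iff h).2 ⟨h1, h2⟩]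
        · exact absurd h (not_exists.2 h1)
    · have hacc : accepted P S (ω a) (f a) = none := by
        unfold accepted
        rw [dif_neg h]
      rw [hacc]
      constructor
      · exact fun hg => Or.inr ⟨not_exists.1 h, hg⟩
      · rintro (⟨m, ⟨h1, _⟩, _⟩ | ⟨_, hg⟩)
        · exact absurd ⟨m, h1⟩ h
        · exact hg
  rw [this]
  refine MeasurableSet.union (MeasurableSet.iUnion fun m => ((hV m).inter ?_).inter ?_)
    ((MeasurableSet.iInter fun i => (hV i).compl).inter (h0 hA))
  · exact MeasurableSet.iInter fun i => MeasurableSet.iInter fun _ => (hV i).compl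
  · exact hs _ (hr m) hA

theorem MeasurableState.step (P : Params n T d) (loss : Fin T → X → Model d → ℝ)
    (D : Dataset n X) (S : Simulator.{v} n T d) {ω : α → S.Coins} (hω : Measurable ω)
    {Z : α → Fin T → Fin d → ℝ} (hZ : Measurable Z) {f : α → State n T d}
    (hf : MeasurableState f) :
    MeasurableState fun a => step P loss D S (ω a) (Matrix.of (Z a)) (f a) := by
  have h1 : ∀ a, IdealFTRL.step P loss D S (ω a) (Matrix.of (Z a)) (f a) =
      (accepted P S (ω a) (f a)).elim (f a)
        fun r => IdealFTRL.process P loss D (Matrix.of (Z a)) (f a) r := by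
    intro a
    rcases h : accepted P S (ω a) (f a) with _ | r
    · exact step_of_accepted_none loss D _ h
    · exact step_of_accepted_some loss D _ h
  simp only [h1]
  constructor
  · exact measurable_accepted P S hω hf (g := fun a o => (o.elim (f a) fun r =>
      IdealFTRL.process P loss D (Matrix.of (Z a)) (f a) r).H) hf.H
      fun r hr => (hf.process P loss D hr hZ).H
  · exact measurable_accepted P S hω hf (g := fun a o => (o.elim (f a) fun r =>
      IdealFTRL.process P loss D (Matrix.of (Z a)) (f a) r).used) hf.used
      fun r hr => (hf.process P loss D hr hZ).used
  · exact measurable_accepted P S hω hf (g := fun a o => (o.elim (f a) fun r =>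
      IdealFTRL.process P loss D (Matrix.of (Z a)) (f a) r).θ) hf.θ
      fun r hr => (hf.process P loss D hr hZ).θ
  · exact measurable_accepted P S hω hf (g := fun a o => (o.elim (f a) fun r =>
      IdealFTRL.process P loss D (Matrix.of (Z a)) (f a) r).sent) hf.sent
      fun r hr => (hf.process P loss D hr hZ).sent

theorem stateAfter_succ (P : Params n T d) (loss : Fin T → X → Model d → ℝ) (D : Dataset n X)
    (S : Simulator.{v} n T d) (ω : S.Coins) (Z : Matrix (Fin T) (Fin d) ℝ) (t : ℕ) :
    stateAfter P loss D S ω Z (t + 1) = step P loss D S ω Z (stateAfter P loss D S ω Z t) :=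
  Function.iterate_succ_apply' _ _ _

theorem measurableState_stateAfter (P : Params n T d) (loss : Fin T → X → Model d → ℝ)
    (D : Dataset n X) (S : Simulator.{v} n T d) {ω : α → S.Coins} (hω : Measurable ω)
    {Z : α → Fin T → Fin d → ℝ} (hZ : Measurable Z) (t : ℕ) :
    MeasurableState fun a => stateAfter P loss D S (ω a) (Matrix.of (Z a)) t := by
  induction t with
  | zero => exact ⟨measurable_const, measurable_const, measurable_const, measurable_const⟩
  | succ t ih =>
    simp only [stateAfter_succ]
    exact ih.step P loss D S hω hZ

end

/-! ### Coupling the executions on two data sets -/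

/-- The difference of the contributions of two data sets to the row of an accepted input. -/
def increment (P : Params n T d) (loss : Fin T → X → Model d → ℝ) (D D' : Dataset n X)
    (o : Option (Request n T d)) : Fin T → Fin d → ℝ :=
  o.elim 0 fun r => Function.update 0 r.k
    (WithLp.ofLp (∑ j ∈ r.cohort, (contribution P loss D r j - contribution P loss D' r j)))

/-- The accumulated differences of the contributions of two data sets, for the inputs in the
execution on the first one. -/
def shift (P : Params n T d) (loss : Fin T → X → Model d → ℝ) (D D' : Dataset n X)
    (S : Simulator.{v} n T d) (ω : S.Coins) (Z : Fin T → Fin d → ℝ) : ℕ → Fin T → Fin d → ℝ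
  | 0 => 0
  | t + 1 => shift P loss D D' S ω Z t +
      increment P loss D D' (accepted P S ω (stateAfter P loss D S ω (Matrix.of Z) t))

/-- Multiplication with an invertible matrix, as a linear equivalence. -/
def mulEquiv (d : ℕ) (C : Matrix (Fin T) (Fin T) ℝ) (hC : IsUnit C.det) :
    (Fin T → Fin d → ℝ) ≃ₗ[ℝ] (Fin T → Fin d → ℝ) where
  toFun W := fun k l => (C * Matrix.of W) k l
  invFun Z := fun k l => (C⁻¹ * Matrix.of Z) k l
  map_add' W W' := by
    ext k l
    change (C * (Matrix.of W + Matrix.of W')) k l = _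
    rw [Matrix.mul_add]
    rfl
  map_smul' c W := by
    ext k l
    change (C * (c • Matrix.of W)) k l = _
    rw [Matrix.mul_smul]
    rfl
  left_inv W := by
    have := Matrix.nonsing_inv_mul_cancel_left C (Matrix.of W) hC
    ext k l
    exact congrFun (congrFun this k) l
  right_inv Z := by
    have := Matrix.mul_nonsing_inv_cancel_left C (Matrix.of Z) hC
    ext k l
    exact congrFun (congrFun this k) l

section

variable {P : Params n T d} {loss : Fin T → X → Model d → ℝ} {D D' : Dataset n X}
  {S : Simulator.{v} n T d} {ω : S.Coins}

theorem used_subset_succ (Z : Matrix (Fin T) (Fin d) ℝ) (t : ℕ) :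
    (stateAfter P loss D S ω Z t).used ⊆ (stateAfter P loss D S ω Z (t + 1)).used := by
  rw [stateAfter_succ]
  rcases h : accepted P S ω (stateAfter P loss D S ω Z t) with _ | r
  · rw [step_of_accepted_none loss D Z h]
  · rw [step_of_accepted_some loss D Z h]
    exact Finset.subset_insert _ _

theorem shift_eq_zero (Z : Fin T → Fin d → ℝ) (t : ℕ) {k : Fin T}
    (hk : k ∉ (stateAfter P loss D S ω (Matrix.of Z) t).used) :
    shift P loss D D' S ω Z t k = 0 := by
  induction t with
  | zero => rfl
  | succ t ih =>
    have h1 := ih fun h => hk (used_subset_succ _ _ h)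
    rw [stateAfter_succ] at hk
    rw [shift, Pi.add_apply, h1, zero_add]
    rcases h : accepted P S ω (stateAfter P loss D S ω (Matrix.of Z) t) with _ | r
    · rfl
    · rw [step_of_accepted_some loss D _ h] at hk
      have : k ≠ r.k := fun h => hk (h ▸ Finset.mem_insert_self _ _)
      simp [increment, this]

/-- The noise compensates the difference of the gradients. By induction the states agree, hence so
does the next accepted input, whose row then receives the same value in both executions. Only the
rows in `used` matter, which makes the same statement usable for independence of unused rows. -/
theorem stateAfter_eq_of_shift (hζ : P.ζ ≠ 0) {Z Z' : Fin T → Fin d → ℝ} {t : ℕ}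
    (h : ∀ k ∈ (stateAfter P loss D S ω (Matrix.of Z) t).used,
      (P.C⁻¹ * Matrix.of Z') k = (P.C⁻¹ * Matrix.of Z) k +
        P.ζ⁻¹ • shift P loss D D' S ω Z t k) :
    stateAfter P loss D' S ω (Matrix.of Z') t = stateAfter P loss D S ω (Matrix.of Z) t := by
  induction t with
  | zero => rfl
  | succ t ih =>
    -- A valid input has a fresh index, so the rows of earlier rounds keep their shift.
    have hinc : ∀ k ∈ (stateAfter P loss D S ω (Matrix.of Z) t).used,
        increment P loss D D' (accepted P S ω (stateAfter P loss D S ω (Matrix.of Z) t)) k = 0 := by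
      intro k hk
      rcases ha : accepted P S ω (stateAfter P loss D S ω (Matrix.of Z) t) with _ | r
      · rfl
      · have : k ≠ r.k := fun h => (valid_of_accepted ha).2 (h ▸ hk)
        simp [increment, this]
    have hst := ih fun k hk => by
      rw [h k (used_subset_succ _ _ hk), shift, Pi.add_apply, hinc k hk, add_zero]
    rw [stateAfter_succ, stateAfter_succ, hst]
    rcases ha : accepted P S ω (stateAfter P loss D S ω (Matrix.of Z) t) with _ | r
    · rw [step_of_accepted_none _ _ _ ha, step_of_accepted_none _ _ _ ha]
    · rw [step_of_accepted_some _ _ _ ha, step_of_accepted_some _ _ _ ha]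
      have hr : r.k ∈ (stateAfter P loss D S ω (Matrix.of Z) (t + 1)).used := by
        rw [stateAfter_succ, step_of_accepted_some _ _ _ ha]
        exact Finset.mem_insert_self _ _
      have hagg : aggregate P loss D' (Matrix.of Z') r = aggregate P loss D (Matrix.of Z) r := by
        have h0 := shift_eq_zero (D' := D') Z t (valid_of_accepted ha).2
        unfold aggregate
        rw [h r.k hr, shift, Pi.add_apply, h0, zero_add, ha]
        simp only [increment, Option.elim_some, Function.update_self, WithLp.toLp_add,
          WithLp.toLp_smul, WithLp.toLp_ofLp, smul_add, smul_smul, mul_inv_cancel₀ hζ, one_smul,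
          Finset.sum_sub_distrib]
        abel
      unfold process
      rw [hagg]

theorem shift_self (Z : Fin T → Fin d → ℝ) (t : ℕ) : shift P loss D D S ω Z t = 0 := by
  induction t with
  | zero => rfl
  | succ t ih =>
    rw [shift, ih, zero_add]
    rcases accepted P S ω (stateAfter P loss D S ω (Matrix.of Z) t) with _ | r
    · rfl
    · ext k l
      simp [increment]

/-- This is the coupling of `D` with itself: the execution has read only the used rows of `C⁻¹ Z`.
-/
theorem stateAfter_congr (hζ : P.ζ ≠ 0) {Z Z' : Fin T → Fin d → ℝ} {t : ℕ}
    (h : ∀ k ∈ (stateAfter P loss D S ω (Matrix.of Z) t).used,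
      (P.C⁻¹ * Matrix.of Z') k = (P.C⁻¹ * Matrix.of Z) k) :
    stateAfter P loss D S ω (Matrix.of Z') t = stateAfter P loss D S ω (Matrix.of Z) t :=
  stateAfter_eq_of_shift hζ fun k hk => by rw [h k hk, shift_self]; simp

theorem shift_congr (hζ : P.ζ ≠ 0) {Z Z' : Fin T → Fin d → ℝ} {t : ℕ}
    (h : ∀ k ∈ (stateAfter P loss D S ω (Matrix.of Z) t).used,
      (P.C⁻¹ * Matrix.of Z') k = (P.C⁻¹ * Matrix.of Z) k) :
    shift P loss D D' S ω Z' t = shift P loss D D' S ω Z t := by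
  induction t with
  | zero => rfl
  | succ t ih =>
    have h' := fun k hk => h k (used_subset_succ _ _ hk)
    rw [shift, shift, ih h', stateAfter_congr hζ h']

theorem measurable_increment_accepted {α : Type*} [MeasurableSpace α] {f : α → State n T d}
    (hf : MeasurableState f) :
    Measurable fun a => increment P loss D D' (accepted P S ω (f a)) := by
  refine measurable_accepted P S measurable_const hf
    (g := fun _ o => increment P loss D D' o) measurable_const fun r hr => ?_
  refine measurable_pi_iff.2 fun k => ?_
  simp only [increment, Option.elim_some, Function.update_apply]
  refine Measurable.ite (hr.k (MeasurableSet.of_discrete (s := {i | k = i}))) ?_ measurable_const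
  have h1 := hr.sum_cohort fun j => (hr.contribution P loss D j).sub (hr.contribution P loss D' j)
  exact (WithLp.measurable_ofLp 2 _).comp h1

theorem measurable_shift (t : ℕ) : Measurable fun Z => shift P loss D D' S ω Z t := by
  induction t with
  | zero => exact measurable_const
  | succ t ih =>
    exact ih.add (measurable_increment_accepted
      (measurableState_stateAfter P loss D S measurable_const measurable_id t))

theorem measurable_mulEquiv (C : Matrix (Fin T) (Fin T) ℝ) (hC : IsUnit C.det) :
    Measurable (mulEquiv d C hC) :=
  (mulEquiv d C hC).toLinearMap.continuous_of_finiteDimensional.measurable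

/-- In the coordinates `W = C⁻¹ Z` each iteration moves one unread row by an amount determined by
rows already read, so the map is a composition of adaptive shears. -/
theorem measurePreserving_add_shift (hC : IsUnit P.C.det) (hζ : P.ζ ≠ 0) (c : ℝ) (t : ℕ) :
    MeasurePreserving (fun W : Fin T → Fin d → ℝ =>
      W + c • shift P loss D D' S ω (mulEquiv d P.C hC W) t) volume volume := by
  set L := mulEquiv d P.C hC with hL
  have hinv : ∀ W, (P.C⁻¹ * Matrix.of (L W) : Matrix _ _ _) = Matrix.of W := fun W =>
    L.symm_apply_apply W
  induction t with
  | zero =>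
    simp only [shift, smul_zero, add_zero]
    exact MeasurePreserving.id volume
  | succ t ih =>
    let st : (Fin T → Fin d → ℝ) → State n T d :=
      fun W => stateAfter P loss D S ω (Matrix.of (L W)) t
    have hst : MeasurableState st :=
      measurableState_stateAfter P loss D S measurable_const (measurable_mulEquiv P.C hC) t
    let k : (Fin T → Fin d → ℝ) → Option (Fin T) :=
      fun W => (accepted P S ω (st W)).map Request.k
    let f : (Fin T → Fin d → ℝ) → Fin T → Fin d → ℝ :=
      fun W => c • increment P loss D D' (accepted P S ω (st W))
    have hk : ∀ o, MeasurableSet {W | k W = o} := by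
      intro o
      refine measurableSet_setOfPred.2 ?_
      refine measurable_accepted P S measurable_const hst
        (g := fun _ o' => (o'.map Request.k = o)) measurable_const fun r hr => ?_
      exact measurableSet_setOfPred.1 (hr.k (MeasurableSet.of_discrete (s := {i | some i = o})))
    have hf : Measurable f := (measurable_increment_accepted hst).const_smul c
    have hupd : ∀ W i v, k W = some i → ∀ i' ∈ (st W).used,
        (P.C⁻¹ * Matrix.of (L (Function.update W i v))) i' = (P.C⁻¹ * Matrix.of (L W)) i' := by
      intro W i v hi i' hi'
      rw [hinv, hinv]
      obtain ⟨r, hr, rfl⟩ := Option.map_eq_some_iff.1 hi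
      exact Function.update_of_ne (fun h : i' = r.k => (valid_of_accepted hr).2 (h ▸ hi')) _ _
    have hstupd : ∀ W i v, k W = some i → st (Function.update W i v) = st W := fun W i v hi =>
      stateAfter_congr hζ (hupd W i v hi)
    have h0 : ∀ W i, k W ≠ some i → f W i = 0 := by
      intro W i hi
      simp only [f, k] at hi ⊢
      rcases ha : accepted P S ω (st W) with _ | r
      · simp [increment]
      · rw [ha, Option.map_some, ne_eq, Option.some_inj] at hi
        simp [increment, Function.update_of_ne (Ne.symm hi)]
    have hmp : MeasurePreserving (fun W => W + f W) volume volume := by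
      refine measurePreserving_adaptive_add (volume : Measure (Fin d → ℝ)) k hk hf h0 ?_
      intro W i v hi
      simp only [k, f] at hi ⊢
      rw [hstupd W i v hi]
      exact ⟨hi, rfl⟩
    -- The newest shear is applied first: it alters only a row unread after `t` iterations, so the
    -- earlier shift takes the same value before and after it.
    have hcomp := ih.comp hmp
    convert hcomp using 1
    ext1 W
    have hsh : shift P loss D D' S ω (L (W + f W)) t = shift P loss D D' S ω (L W) t := by
      rcases hkW : k W with _ | i
      · have : f W = 0 := funext fun i => h0 W i (by simp [hkW])
        rw [this, add_zero]
      · have : W + f W = Function.update W i (W i + f W i) := by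
          ext1 j
          by_cases hj : j = i
          · subst hj; simp
          · rw [Function.update_of_ne hj, Pi.add_apply,
              h0 W j (by rw [hkW]; simpa using fun h => hj h.symm), add_zero]
        rw [this]
        exact shift_congr hζ (hupd W i _ hkW)
    simp only [Function.comp_apply, hsh, shift, smul_add]
    rw [add_assoc, add_comm (c • shift P loss D D' S ω (L W) t)]

end

/-! ### Bounds for the difference of the contributions -/

theorem norm_clip_le {ζ : ℝ} (hζ : 0 ≤ ζ) (v : Model d) : ‖clip ζ v‖ ≤ ζ := by
  have h0 : 0 ≤ min 1 (ζ / ‖v‖) := le_min zero_le_one (div_nonneg hζ (norm_nonneg _))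
  rw [clip, norm_smul, Real.norm_of_nonneg h0]
  rcases (norm_nonneg v).eq_or_lt with h | h
  · rw [← h, mul_zero]; exact hζ
  · calc _ ≤ ζ / ‖v‖ * ‖v‖ := mul_le_mul_of_nonneg_right (min_le_right _ _) h.le
      _ = ζ := div_mul_cancel₀ _ h.ne'

theorem clip_eq_self {ζ : ℝ} {v : Model d} (hv : ‖v‖ ≤ ζ) : clip ζ v = v := by
  rcases eq_or_ne v 0 with rfl | h
  · simp [clip]
  · rw [clip, min_eq_left, one_smul]
    rwa [one_le_div (norm_pos_iff.2 h)]

theorem norm_honestGradient_le {ζ : ℝ} (hζ : 0 ≤ ζ) (loss : X → Model d → ℝ) (x : Option X)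
    (θ : Model d) : ‖honestGradient ζ loss x θ‖ ≤ ζ := by
  rcases x with _ | x
  · simpa [honestGradient] using hζ
  · exact norm_clip_le hζ _

/-- The differences that one client can make: each row is bounded by `ζ`, and the nonzero rows are
in a pattern of the schema. -/
def admissible (P : Params n T d) : Set (Fin T → Fin d → ℝ) :=
  {v | (∀ k, ‖WithLp.toLp 2 (v k)‖ ≤ P.ζ) ∧ (v = 0 ∨ ∃ π ∈ P.schema, ∀ k ∉ π, v k = 0)}

theorem contribution_congr {P : Params n T d} {loss : Fin T → X → Model d → ℝ}
    {D D' : Dataset n X} (r : Request n T d) {j : Fin n} (h : D j = D' j) :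
    contribution P loss D r j = contribution P loss D' r j := by
  rw [contribution, contribution, h]

theorem norm_contribution_sub_le {P : Params n T d} (hζ : 0 ≤ P.ζ)
    (loss : Fin T → X → Model d → ℝ) {D D' : Dataset n X} (r : Request n T d) {j : Fin n}
    (h : D j = none ∨ D' j = none) :
    ‖contribution P loss D r j - contribution P loss D' r j‖ ≤ P.ζ := by
  have key : ‖honestGradient P.ζ (loss r.k) (D j) r.θ -
      honestGradient P.ζ (loss r.k) (D' j) r.θ‖ ≤ P.ζ := by
    rcases h with h | h
    · rw [h, show honestGradient P.ζ (loss r.k) none r.θ = 0 from rfl, zero_sub, norm_neg]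
      exact norm_honestGradient_le hζ _ _ _
    · rw [h, show honestGradient P.ζ (loss r.k) none r.θ = 0 from rfl, sub_zero]
      exact norm_honestGradient_le hζ _ _ _
  unfold contribution
  split_ifs
  · rcases r.g j with _ | w
    · exact key
    · simpa using hζ
  · exact key

/-- Only the client `j` with differing records contributes, and one of its two honest gradients is
zero, so clipping bounds each row by `ζ`; replaced gradients cancel. The support lies in the history
of `j`, which qualification keeps inside a pattern. The alternative of an empty history covers an
empty schema. -/
theorem shift_mem_admissible {P : Params n T d} (hζ : 0 ≤ P.ζ) {loss : Fin T → X → Model d → ℝ}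
    {D D' : Dataset n X} (hD : Adjacent D D') (S : Simulator.{v} n T d) (ω : S.Coins)
    (Z : Fin T → Fin d → ℝ) (t : ℕ) : shift P loss D D' S ω Z t ∈ admissible P := by
  obtain ⟨j, hne, hj⟩ := hD
  have hnone : D j = none ∨ D' j = none := by tauto
  have key : (∀ k, ‖WithLp.toLp 2 (shift P loss D D' S ω Z t k)‖ ≤ P.ζ) ∧
      (∀ k ∉ (stateAfter P loss D S ω (Matrix.of Z) t).H j, shift P loss D D' S ω Z t k = 0) ∧
      ((stateAfter P loss D S ω (Matrix.of Z) t).H j = ∅ ∨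
        ∃ π ∈ P.schema, (stateAfter P loss D S ω (Matrix.of Z) t).H j ⊆ π) := by
    induction t with
    | zero =>
      refine ⟨fun k => ?_, fun k _ => rfl, Or.inl rfl⟩
      simpa [shift] using hζ
    | succ t ih =>
      obtain ⟨h1, h2, h3⟩ := ih
      rw [stateAfter_succ, shift]
      rcases ha : accepted P S ω (stateAfter P loss D S ω (Matrix.of Z) t) with _ | r
      · rw [step_of_accepted_none _ _ _ ha]
        simpa [increment] using ⟨h1, h2, h3⟩
      · rw [step_of_accepted_some _ _ _ ha]
        have hv := valid_of_accepted ha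
        have hs0 := shift_eq_zero (D' := D') Z t hv.2
        have hsum : ∑ i ∈ r.cohort, (contribution P loss D r i - contribution P loss D' r i) =
            if j ∈ r.cohort then contribution P loss D r j - contribution P loss D' r j else 0 := by
          rw [← Finset.sum_ite_eq' r.cohort j
            fun i => contribution P loss D r i - contribution P loss D' r i]
          refine Finset.sum_congr rfl fun i _ => ?_
          split_ifs with hi
          · rfl
          · rw [contribution_congr r (hne i hi), sub_self]
        have hrow : ∀ k, (shift P loss D D' S ω Z t + increment P loss D D' (some r)) k =
            if k = r.k then WithLp.ofLp (if j ∈ r.cohort then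
              contribution P loss D r j - contribution P loss D' r j else 0)
            else shift P loss D D' S ω Z t k := by
          intro k
          rw [Pi.add_apply, increment, Option.elim_some, Function.update_apply, hsum]
          by_cases hk : k = r.k
          · rw [if_pos hk, if_pos hk, hk, hs0, zero_add]
          · rw [if_neg hk, if_neg hk, Pi.zero_apply, add_zero]
        simp only [hrow, process, History.update]
        refine ⟨fun k => ?_, fun k hk => ?_, ?_⟩
        · by_cases hk : k = r.k
          · rw [if_pos hk, WithLp.toLp_ofLp]
            split_ifs
            · exact norm_contribution_sub_le hζ loss r hnone
            · simpa using hζ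
          · rw [if_neg hk]
            exact h1 k
        · by_cases hjc : j ∈ r.cohort
          · rw [if_pos hjc, Finset.mem_insert, not_or] at hk
            rw [if_neg hk.1, h2 k hk.2]
          · rw [if_neg hjc] at hk
            rw [if_neg hjc, h2 k hk]
            simp
        · by_cases hjc : j ∈ r.cohort
          · have := hv.1 hjc
            simp only [fQualify, Finset.mem_filter, Finset.mem_univ, true_and] at this
            rw [if_pos hjc]
            exact Or.inr this
          · rw [if_neg hjc]
            exact h3
  obtain ⟨h1, h2, h3⟩ := key
  refine ⟨h1, ?_⟩
  rcases h3 with h3 | ⟨π, hπ, h3⟩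
  · left
    funext k
    exact h2 k (by simp [h3])
  · exact Or.inr ⟨π, hπ, fun k hk => h2 k fun h => hk (h3 h)⟩

/-- Compactness lets one admissible matrix attain the maximal sensitivity; there are only finitely
many patterns. -/
theorem isCompact_admissible (P : Params n T d) : IsCompact (admissible P) := by
  refine Metric.isCompact_of_isClosed_isBounded ?_ ?_
  · have h1 : IsClosed {v : Fin T → Fin d → ℝ | ∀ k, ‖WithLp.toLp 2 (v k)‖ ≤ P.ζ} := by
      simp only [Set.ofPred_forall]
      refine isClosed_iInter fun k => isClosed_le ?_ continuous_const
      exact ((PiLp.continuous_toLp 2 _).comp (continuous_apply k)).norm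
    have h2 : IsClosed {v : Fin T → Fin d → ℝ | v = 0 ∨ ∃ π ∈ P.schema, ∀ k ∉ π, v k = 0} := by
      have : {v : Fin T → Fin d → ℝ | v = 0 ∨ ∃ π ∈ P.schema, ∀ k ∉ π, v k = 0} =
          {0} ∪ ⋃ π ∈ P.schema, ⋂ k, ⋂ (_ : k ∉ π), {v | v k = 0} := by
        ext v
        simp
      rw [this]
      refine isClosed_singleton.union (Set.Finite.isClosed_biUnion (Set.toFinite _) fun π _ => ?_)
      refine isClosed_iInter fun k => isClosed_iInter fun _ => ?_
      exact isClosed_eq (continuous_apply k) continuous_const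
    exact h1.inter h2
  · refine (Metric.isBounded_closedBall (x := (0 : Fin T → Fin d → ℝ)) (r := max P.ζ 0)).subset ?_
    intro v hv
    rw [mem_closedBall_zero_iff, pi_norm_le_iff_of_nonneg (le_max_right _ _)]
    intro k
    rw [pi_norm_le_iff_of_nonneg (le_max_right _ _)]
    intro l
    refine le_trans ?_ ((hv.1 k).trans (le_max_left _ _))
    exact PiLp.norm_apply_le (WithLp.toLp 2 (v k)) l

/-! ### A standard simulator with linear losses -/

/-- The losses with the constant gradients `v k`. -/
def linearLoss (X : Type u) (v : Fin T → Fin d → ℝ) (k : Fin T) (_ : X) (θ : Model d) : ℝ :=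
  inner ℝ (WithLp.toLp 2 (v k)) θ

theorem hasGradientAt_linearLoss (v : Fin T → Fin d → ℝ) (k : Fin T) (x : X) (θ : Model d) :
    HasGradientAt (linearLoss X v k x) (WithLp.toLp 2 (v k)) θ :=
  (InnerProductSpace.toDual ℝ (Model d) (WithLp.toLp 2 (v k))).hasFDerivAt

theorem honestGradient_linearLoss {ζ : ℝ} {v : Fin T → Fin d → ℝ} {k : Fin T}
    (hv : ‖WithLp.toLp 2 (v k)‖ ≤ ζ) (x : X) (θ : Model d) :
    honestGradient ζ (linearLoss X v k) (some x) θ = WithLp.toLp 2 (v k) := by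
  rw [honestGradient, (hasGradientAt_linearLoss v k x θ).gradient, clip_eq_self hv]

/-- The round with a given number, or `k₀` if there is none. -/
def round (k₀ : Fin T) (t : ℕ) : Fin T := if h : t < T then ⟨t, h⟩ else k₀

theorem round_eq (k₀ : Fin T) {t : ℕ} (h : t < T) : round k₀ t = ⟨t, h⟩ := dif_pos h

/-- The input of standard DP-FTRL where only the client `j` participates, in the rounds `π`. -/
def standardRequest (P : Params n T d) (j : Fin n) (π : Finset (Fin T)) (k₀ : Fin T)
    (h : Transcript T d) : Request n T d where
  cohort := if round k₀ h.1 ∈ π then {j} else ∅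
  k := round k₀ h.1
  θ := if h.1 = 0 then P.θ₀ else message h (h.1 - 1) (round k₀ (h.1 - 1))
  g _ := none

/-- Standard DP-FTRL where only the client `j` participates, in the rounds `π`. -/
def standardSimulator (P : Params n T d) (j : Fin n) (π : Finset (Fin T)) (k₀ : Fin T) :
    Simulator.{v} n T d where
  Coins := PUnit
  law := Measure.dirac PUnit.unit
  request _ h _ := standardRequest P j π k₀ h
  measurable_cohort _ := (Measurable.of_discrete (f := fun t : ℕ =>
    if round k₀ t ∈ π then ({j} : Finset (Fin n)) else ∅)).comp
      (measurable_length.comp measurable_snd)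
  measurable_k _ := (Measurable.of_discrete (f := round k₀)).comp
    (measurable_length.comp measurable_snd)
  measurable_θ _ := by
    have h1 : ∀ t : ℕ, Measurable fun h : Transcript T d =>
        if t = 0 then P.θ₀ else message h (t - 1) (round k₀ (t - 1)) := by
      intro t
      split_ifs
      · exact measurable_const
      · exact (measurable_pi_apply _).comp (measurable_message (t - 1))
    exact measurable_apply_countable h1 (measurable_length.comp measurable_snd) measurable_snd
  measurableSet_g _ _ := by simp [standardRequest]
  measurable_g _ _ := measurable_const

theorem accepted_eq_of_valid_zero {P : Params n T d} {S : Simulator.{v} n T d} {ω : S.Coins}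
    {st : State n T d} (h : Valid P st (S.request ω st.sent 0)) :
    accepted P S ω st = some (S.request ω st.sent 0) := by
  classical
  have h' : ∃ m, Valid P st (S.request ω st.sent m) := ⟨0, h⟩
  unfold accepted
  rw [dif_pos h', (Nat.find_eq_zero h').2 h]

section

variable {P : Params n T d} {π : Finset (Fin T)} {st : State n T d} {t : ℕ}

/-- The properties of the states of standard DP-FTRL where only the client `j` participates, in the
rounds `π`. -/
structure StandardState (j : Fin n) (π : Finset (Fin T)) (st : State n T d) (t : ℕ) : Prop where
  length : st.sent.1 = t
  used : ∀ k ∈ st.used, (k : ℕ) < t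
  H : st.H j ⊆ π
  message : t ≠ 0 → message st.sent (t - 1) = prefixRows (t - 1) st.θ

theorem StandardState.cohort_subset {j : Fin n} (h : StandardState j π st t) (hπ : π ∈ P.schema)
    (k₀ : Fin T) : (standardRequest P j π k₀ st.sent).cohort ⊆
      fQualify P.schema st.H (round k₀ t) := by
  intro i hi
  simp only [standardRequest, h.length] at hi
  split_ifs at hi with hk
  · rw [Finset.mem_singleton] at hi
    subst hi
    simp only [fQualify, Finset.mem_filter, Finset.mem_univ, true_and]
    exact ⟨π, hπ, Finset.insert_subset hk h.H⟩
  · simp at hi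

theorem StandardState.valid {j : Fin n} (h : StandardState j π st t) (hπ : π ∈ P.schema)
    (k₀ : Fin T) (ht : t < T) : Valid P st (standardRequest P j π k₀ st.sent) := by
  have hk : (standardRequest P j π k₀ st.sent).k = round k₀ t := by
    simp only [standardRequest, h.length]
  refine ⟨hk ▸ h.cohort_subset hπ k₀, fun hu => ?_⟩
  have := h.used _ hu
  rw [hk, round_eq k₀ ht] at this
  exact lt_irrefl _ this

theorem StandardState.step_eq {j : Fin n} (h : StandardState j π st t) (hπ : π ∈ P.schema)
    (k₀ : Fin T) (ht : t < T) (loss : Fin T → X → Model d → ℝ) (D : Dataset n X)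
    (ω : (standardSimulator.{v} P j π k₀).Coins) (Z : Matrix (Fin T) (Fin d) ℝ) :
    step P loss D (standardSimulator.{v} P j π k₀) ω Z st =
      process P loss D Z st (standardRequest P j π k₀ st.sent) :=
  step_of_accepted_some loss D Z (accepted_eq_of_valid_zero (h.valid hπ k₀ ht))

theorem standardState_stateAfter (j : Fin n) (hπ : π ∈ P.schema)
    (k₀ : Fin T) (loss : Fin T → X → Model d → ℝ) (D : Dataset n X)
    (ω : (standardSimulator.{v} P j π k₀).Coins) (Z : Matrix (Fin T) (Fin d) ℝ) (ht : t ≤ T) :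
    StandardState j π (stateAfter P loss D (standardSimulator.{v} P j π k₀) ω Z t) t := by
  induction t with
  | zero =>
    exact ⟨rfl, fun k hk => by simp [stateAfter, State.init] at hk,
      Finset.empty_subset _, fun h => absurd rfl h⟩
  | succ t ih =>
    have h := ih (Nat.le_of_succ_le ht)
    rw [stateAfter_succ, h.step_eq hπ k₀ ht]
    refine ⟨?_, fun k hk => ?_, ?_, fun _ => ?_⟩
    · simp [process, h.length]
    · simp only [process, Finset.mem_insert, standardRequest, h.length, round_eq k₀ ht] at hk
      rcases hk with rfl | hk
      · simp
      · exact (h.used k hk).trans (Nat.lt_succ_self t)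
    · simp only [process, History.update, standardRequest, h.length]
      by_cases hk : round k₀ t ∈ π
      · simpa [hk] using Finset.insert_subset hk h.H
      · simpa [hk] using h.H
    · simp only [process, message_snoc, h.length, Nat.add_sub_cancel, if_true]

theorem StandardState.request_θ {j : Fin n} {t : Fin T} (h : StandardState j π st t) (k₀ : Fin T) :
    (standardRequest P j π k₀ st.sent).θ = previousModel P st t := by
  simp only [standardRequest, previousModel, h.length]
  split_ifs with h0
  · rfl
  · have hlt : (t : ℕ) - 1 < T := lt_of_le_of_lt (Nat.sub_le _ _) t.isLt
    rw [h.message h0, round_eq k₀ hlt]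
    simp [prefixRows]

theorem isStandard_standardSimulator (j : Fin n) (hπ : π ∈ P.schema)
    (k₀ : Fin T) (loss : Fin T → X → Model d → ℝ) :
    IsStandard P loss (standardSimulator.{v} P j π k₀) := by
  intro D ω Z t
  have h := standardState_stateAfter j hπ k₀ loss D ω Z t.isLt.le
  have hr : round k₀ (t : ℕ) = t := round_eq k₀ t.isLt
  refine ⟨?_, ?_, ?_, fun _ => rfl⟩
  · change round k₀ _ = t
    rw [h.length, hr]
  · have := h.cohort_subset hπ k₀
    rwa [hr] at this
  · exact h.request_θ k₀

/-- Linear losses have gradients independent of the model, and the norm bound makes clipping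
inactive, so adaptivity disappears. Outside `π` the cohort is empty, in agreement with `v k = 0`. -/
theorem stateAfter_standardSimulator_row (j : Fin n) (hπ : π ∈ P.schema) (k₀ : Fin T)
    {v : Fin T → Fin d → ℝ} (hv : ∀ k, ‖WithLp.toLp 2 (v k)‖ ≤ P.ζ) (hv0 : ∀ k ∉ π, v k = 0)
    (D : Dataset n X) (ω : (standardSimulator.{v} P j π k₀).Coins)
    (Z : Matrix (Fin T) (Fin d) ℝ) (ht : t ≤ T) (k : Fin T) (hk : (k : ℕ) < t) :
    (stateAfter P (linearLoss X v) D (standardSimulator.{v} P j π k₀) ω Z t).θ k =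
      (D j).elim 0 (fun _ => WithLp.toLp 2 (v k)) + P.ζ • WithLp.toLp 2 ((P.C⁻¹ * Z) k) := by
  induction t with
  | zero => exact absurd hk (Nat.not_lt_zero _)
  | succ t ih =>
    have h := standardState_stateAfter j hπ k₀ (linearLoss X v) D ω Z (Nat.le_of_succ_le ht)
    rw [stateAfter_succ, h.step_eq hπ k₀ ht]
    simp only [process, Function.update_apply]
    have hkr : (standardRequest P j π k₀
        (stateAfter P (linearLoss X v) D (standardSimulator.{v} P j π k₀) ω Z t).sent).k =
        ⟨t, ht⟩ := by
      simp only [standardRequest, h.length, round_eq k₀ ht]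
    split_ifs with hkt
    · rw [aggregate, hkt]
      congr 1
      rw [hkr]
      have hco : (standardRequest P j π k₀ (stateAfter P (linearLoss X v) D
          (standardSimulator.{v} P j π k₀) ω Z t).sent).cohort =
          if (⟨t, ht⟩ : Fin T) ∈ π then {j} else ∅ := by
        simp only [standardRequest, h.length, round_eq k₀ (Nat.lt_of_succ_le ht)]
      rw [hco]
      have hcon : ∀ r : Request n T d, r.k = ⟨t, ht⟩ → r.g j = none →
          contribution P (linearLoss X v) D r j =
          (D j).elim 0 (fun _ => WithLp.toLp 2 (v ⟨t, ht⟩)) := by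
        intro r hr hg
        have : honestGradient P.ζ (linearLoss X v r.k) (D j) r.θ =
            (D j).elim 0 (fun _ => WithLp.toLp 2 (v ⟨t, ht⟩)) := by
          rw [hr]
          rcases D j with _ | x
          · rfl
          · exact honestGradient_linearLoss (hv _) x _
        rw [contribution, hg, Option.getD_none, ite_self, this]
      split_ifs with hmem
      · rw [Finset.sum_singleton]
        exact hcon _ hkr rfl
      · rw [Finset.sum_empty, hv0 _ hmem]
        rcases D j <;> simp
    · refine ih (Nat.le_of_succ_le ht) ?_
      rw [hkr] at hkt
      have : (k : ℕ) ≠ t := fun h => hkt (Fin.ext h)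
      omega

end

/-! ### View probabilities and the consequence of standard privacy -/

theorem measurableSet_view (P : Params n T d) (loss : Fin T → X → Model d → ℝ)
    (S : Simulator.{v} n T d) (D : Dataset n X) {V : Set (View n T d X)} (hV : MeasurableSet V) :
    MeasurableSet {p : S.Coins × (Fin T → Fin d → ℝ) |
      Sum.inr (stateAfter P loss D S p.1 (Matrix.of p.2) T).sent ∈ V} :=
  (measurable_inr.comp
    (measurableState_stateAfter P loss D S measurable_fst measurable_snd T).sent) hV

theorem measure_view_of_dirac (P : Params n T d) (loss : Fin T → X → Model d → ℝ)
    {S : Simulator.{v} n T d} {ω : S.Coins} (hS : S.law = Measure.dirac ω) (D : Dataset n X)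
    {V : Set (View n T d X)} (hV : MeasurableSet V) :
    (S.law.prod (noiseLaw T d P.σ))
      {p | Sum.inr (stateAfter P loss D S p.1 (Matrix.of p.2) T).sent ∈ V} =
    noiseLaw T d P.σ {Z | Sum.inr (stateAfter P loss D S ω (Matrix.of Z) T).sent ∈ V} := by
  rw [hS, Measure.dirac_prod,
    Measure.map_apply measurable_prodMk_left (measurableSet_view P loss S D hV)]
  rfl

/-- The privacy of standard DP-FTRL bounds the distinguishability of the shifts of the noise by
admissible matrices. -/
theorem measure_preimage_add_le_of_standard {P : Params n T d}
    (hC : IsUnit P.C.det) (hζ : 0 < P.ζ) {ε δ δp : ℝ} (hε : 0 ≤ ε) (hδ : 0 ≤ δ) (hδp : 0 ≤ δp)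
    (hstandard : ∀ loss : Fin T → X → Model d → ℝ,
      (∀ k x, Differentiable ℝ (loss k x)) →
      ∀ S : Simulator.{v} n T d, IsStandard P loss S → ViewIsDP P δp loss S ε (δ + δp))
    (j : Fin n) (x : X) (k₀ : Fin T) {v : Fin T → Fin d → ℝ} (hv : v ∈ admissible P)
    {A : Set (Fin T → Fin d → ℝ)} (hA : MeasurableSet A) :
    ENNReal.ofReal (1 - δp) * noiseLaw T d P.σ
        ((fun Z => Z + P.ζ⁻¹ • mulEquiv d P.C hC v) ⁻¹' A) ≤
      ENNReal.ofReal (Real.exp ε) * (ENNReal.ofReal (1 - δp) * noiseLaw T d P.σ A) +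
        ENNReal.ofReal δ := by
  obtain ⟨hv, rfl | ⟨π, hπ, hv0⟩⟩ := hv
  · simp only [map_zero, smul_zero, add_zero, Set.preimage_id']
    refine le_add_right (le_mul_of_one_le_left zero_le ?_)
    rw [← ENNReal.ofReal_one]
    exact ENNReal.ofReal_le_ofReal (Real.one_le_exp hε)
  classical
  set L := mulEquiv d P.C hC
  let S := standardSimulator.{v} P j π k₀
  let D : Dataset n X := fun i => if i = j then some x else none
  let D' : Dataset n X := fun _ => none
  have hadj : Adjacent D D' :=
    ⟨j, fun i hi => by simp [D, D', hi], Or.inl ⟨by simp [D], rfl⟩⟩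
  -- The last message contains all rows; applying `ζ⁻¹ C` to it recovers the noise plus the constant
  -- shift.
  let F : Transcript T d → Fin T → Fin d → ℝ :=
    fun h => P.ζ⁻¹ • L fun k => WithLp.ofLp (message h (T - 1) k)
  have hF : Measurable F := by
    have h : Measurable fun (h : Transcript T d) k => WithLp.ofLp (message h (T - 1) k) :=
      measurable_pi_iff.2 fun k => (WithLp.measurable_ofLp 2 _).comp
        ((measurable_pi_apply k).comp (measurable_message _))
    exact ((measurable_mulEquiv P.C hC).comp h).const_smul P.ζ⁻¹
  have hT : T ≠ 0 := by
    rintro rfl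
    exact k₀.elim0
  have hrow : ∀ (D : Dataset n X) (Z : Fin T → Fin d → ℝ),
      F (stateAfter P (linearLoss X v) D S PUnit.unit (Matrix.of Z) T).sent =
        Z + P.ζ⁻¹ • L ((D j).elim 0 fun _ => v) := by
    intro D Z
    have h := standardState_stateAfter j hπ k₀ (linearLoss X v) D PUnit.unit (Matrix.of Z) le_rfl
    have h1 : (fun k => WithLp.ofLp (message (stateAfter P (linearLoss X v) D S PUnit.unit
        (Matrix.of Z) T).sent (T - 1) k)) = ((D j).elim 0 fun _ => v) + P.ζ • L.symm Z := by
      funext k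
      rw [h.message hT]
      simp only [prefixRows, Nat.le_sub_one_of_lt k.isLt, if_true]
      rw [stateAfter_standardSimulator_row j hπ k₀ hv hv0 D PUnit.unit _ le_rfl k k.isLt]
      rcases D j with _ | x
      · simp only [Option.elim_none, zero_add]
        rfl
      · rfl
    simp only [F]
    rw [h1, map_add, map_smul, L.apply_symm_apply, smul_add, smul_smul,
      inv_mul_cancel₀ hζ.ne', one_smul, add_comm]
  -- Including the leak of `D` but not that of `D'` spends exactly `δp` of the allowance, which
  -- leaves `δ` for the event `A`.
  let V : Set (View n T d X) := Sum.elim (fun D₀ => D₀ = D) fun h => F h ∈ A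
  have hV : MeasurableSet V :=
    measurableSet_sum_iff.2 ⟨trivial, hF hA⟩
  have hdp := hstandard (linearLoss X v)
    (fun k x θ => (hasGradientAt_linearLoss v k x θ).differentiableAt) S
    (isStandard_standardSimulator j hπ k₀ _) D D' hadj V hV
  have hne : D' ≠ D := by
    intro h
    have := congrFun h j
    simp [D, D'] at this
  rw [viewProb, viewProb, measure_view_of_dirac P _ (ω := PUnit.unit) rfl D hV,
    measure_view_of_dirac P _ (ω := PUnit.unit) rfl D' hV, if_pos (show Sum.inl D ∈ V from rfl),
    if_neg (show Sum.inl D' ∉ V from hne), mul_one, mul_zero, zero_add,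
    ENNReal.ofReal_add hδ hδp, ← add_assoc, add_comm,
    ENNReal.add_le_add_iff_right ENNReal.ofReal_ne_top] at hdp
  have h1 : {Z | Sum.inr (stateAfter P (linearLoss X v) D S PUnit.unit (Matrix.of Z) T).sent ∈ V} =
      (fun Z => Z + P.ζ⁻¹ • L v) ⁻¹' A := by
    ext Z
    change F _ ∈ A ↔ _
    rw [hrow D Z]
    simp [D]
  have h2 : {Z | Sum.inr (stateAfter P (linearLoss X v) D' S PUnit.unit (Matrix.of Z) T).sent ∈ V} =
      A := by
    ext Z
    change F _ ∈ A ↔ _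
    rw [hrow D' Z]
    simp [D']
  rwa [h1, h2] at hdp

/-! ### Privacy against arbitrary simulators -/

/-- For each value of the coins, the event for `D` is the preimage of the event for `D'` under a
volume preserving shift of the noise of length at most `Δ`; integrating over the coins keeps the
bound. -/
theorem measure_view_le {P : Params n T d} (hC : IsUnit P.C.det) (hζ : 0 < P.ζ) (hσ : 0 < P.σ)
    {Δ : ℝ} (hΔ : ∀ v ∈ admissible P, frobenius T d (P.ζ⁻¹ • mulEquiv d P.C hC v)
      (P.ζ⁻¹ • mulEquiv d P.C hC v) ≤ Δ ^ 2) (ε : ℝ)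
    (loss : Fin T → X → Model d → ℝ) (S : Simulator.{v} n T d) {D D' : Dataset n X}
    (hD : Adjacent D D') {V : Set (View n T d X)} (hV : MeasurableSet V) :
    (S.law.prod (noiseLaw T d P.σ))
        {p | Sum.inr (stateAfter P loss D S p.1 (Matrix.of p.2) T).sent ∈ V} ≤
      ENNReal.ofReal (Real.exp ε) * (S.law.prod (noiseLaw T d P.σ))
        {p | Sum.inr (stateAfter P loss D' S p.1 (Matrix.of p.2) T).sent ∈ V} +
      gaussianHockeyStick (P.σ ^ 2) Δ ε := by
  have hm := measurableSet_view P loss S D hV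
  have hm' := measurableSet_view P loss S D' hV
  rw [Measure.prod_apply hm, Measure.prod_apply hm',
    ← lintegral_const_mul _ (measurable_measure_prodMk_left hm')]
  have hone : gaussianHockeyStick (P.σ ^ 2) Δ ε =
      ∫⁻ _, gaussianHockeyStick (P.σ ^ 2) Δ ε ∂S.law := by simp
  rw [hone, ← lintegral_add_right _ measurable_const]
  refine lintegral_mono fun ω => ?_
  set L := mulEquiv d P.C hC with hL
  let s : (Fin T → Fin d → ℝ) → Fin T → Fin d → ℝ :=
    fun Z => P.ζ⁻¹ • L (shift P loss D D' S ω Z T)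
  have hs : Measurable s :=
    ((measurable_mulEquiv P.C hC).comp (measurable_shift T)).const_smul P.ζ⁻¹
  have hmp : ∀ c : ℝ, MeasurePreserving (fun Z => Z + c • s Z) volume volume := by
    intro c
    have h1 := measurePreserving_conj volume L (measurePreserving_add_shift (P := P) (loss := loss)
      (D := D) (D' := D') (S := S) (ω := ω) hC hζ.ne' (c * P.ζ⁻¹) T)
    convert h1 using 1
    ext1 Z
    rw [map_add, map_smul, L.apply_symm_apply, mul_smul]
  have hA : MeasurableSet {Z | Sum.inr (stateAfter P loss D' S ω (Matrix.of Z) T).sent ∈ V} :=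
    measurable_prodMk_left hm'
  have key := (hasGaussianDensity_noiseLaw T d hσ).measure_preimage_le_of_le
    (fun Z => hΔ _ (shift_mem_admissible hζ.le hD S ω Z T))
    (measurable_frobenius measurable_id hs) (measurable_frobenius hs hs) hmp ε hA
  refine le_of_eq_of_le (congrArg _ ?_) key
  ext Z
  have hst : stateAfter P loss D' S ω (Matrix.of (Z + s Z)) T =
      stateAfter P loss D S ω (Matrix.of Z) T := by
    refine stateAfter_eq_of_shift hζ.ne' fun k _ => ?_
    have h1 : L.symm (Z + s Z) = L.symm Z + P.ζ⁻¹ • shift P loss D D' S ω Z T := by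
      rw [map_add, map_smul, L.symm_apply_apply]
    exact congrFun h1 k
  simp only [Set.mem_preimage, Set.mem_ofPred_eq]
  rw [hst]

end IdealFTRL

end

/-! ### The worst admissible shift and the conclusion -/

theorem theorem1 {n T d : ℕ} {X : Type u} (P : IdealFTRL.Params n T d)
    (hC : IsUnit P.C.det) (hζ : 0 < P.ζ) (hσ : 0 < P.σ)
    (ε δ δp : ℝ) (hε : 0 ≤ ε) (hδ : 0 ≤ δ) (hδp : 0 ≤ δp) (hδp' : δp ≤ 1)
    (hstandard : ∀ loss : Fin T → X → IdealFTRL.Model d → ℝ,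
      (∀ k x, Differentiable ℝ (loss k x)) →
      ∀ S : IdealFTRL.Simulator.{v} n T d, IdealFTRL.IsStandard P loss S →
        IdealFTRL.ViewIsDP P δp loss S ε (δ + δp)) :
    ∀ loss : Fin T → X → IdealFTRL.Model d → ℝ,
      (∀ k x, Differentiable ℝ (loss k x)) →
      ∀ S' : IdealFTRL.Simulator.{v} n T d, IdealFTRL.ViewIsDP P δp loss S' ε (δ + δp) := by
  open IdealFTRL in
  intro loss _ S D D' hD V hV
  obtain ⟨ω⟩ : Nonempty S.Coins := S.law.nonempty_of_neZero
  -- Any request contains a round index, so the existence of a simulator excludes `T = 0`.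
  let k₀ : Fin T := (S.request ω ⟨0, Fin.elim0⟩ 0).k
  obtain ⟨j, x⟩ : Nonempty (Fin n × X) := by
    obtain ⟨j, _, h | h⟩ := hD
    · exact ⟨j, (D j).get (Option.isSome_iff_ne_none.2 h.1)⟩
    · exact ⟨j, (D' j).get (Option.isSome_iff_ne_none.2 h.2)⟩
  let q : (Fin T → Fin d → ℝ) → ℝ := fun v =>
    frobenius T d (P.ζ⁻¹ • mulEquiv d P.C hC v) (P.ζ⁻¹ • mulEquiv d P.C hC v)
  have hq : Continuous q := by
    have hL : Continuous (mulEquiv d P.C hC) :=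
      (mulEquiv d P.C hC).toLinearMap.continuous_of_finiteDimensional
    simp only [q, frobenius_apply]
    fun_prop
  obtain ⟨v, hv, hmax⟩ := (isCompact_admissible P).exists_isMaxOn
    ⟨0, fun k => by simpa using hζ.le, Or.inl rfl⟩ hq.continuousOn
  have hq0 : 0 ≤ q v := by
    simp only [q, frobenius_apply]
    exact Finset.sum_nonneg fun k _ => Finset.sum_nonneg fun l _ => mul_self_nonneg _
  have hsq : q v = √(q v) ^ 2 := (Real.sq_sqrt hq0).symm
  have hview := measure_view_le hC hζ hσ (Δ := √(q v)) (fun w hw => (hmax hw).trans hsq.le) ε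
    loss S hD hV
  obtain ⟨A, hA, hAeq⟩ := (hasGaussianDensity_noiseLaw T d hσ).exists_measure_preimage_eq
    hsq (measurable_frobenius measurable_id measurable_const) ε
  have hst := measure_preimage_add_le_of_standard hC hζ hε hδ hδp hstandard j x k₀ hv hA
  -- On the extremal set `A` the shifted probability is exactly the `exp ε` term plus the
  -- divergence, so cancelling the finite common term isolates the divergence. The factor `1 - δp`
  -- is kept, not divided out, so `δp = 1` needs no separate case.
  have hhs : ENNReal.ofReal (1 - δp) * gaussianHockeyStick (P.σ ^ 2) √(q v) ε ≤
      ENNReal.ofReal δ := by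
    rw [hAeq, mul_add, mul_left_comm] at hst
    exact (ENNReal.add_le_add_iff_left (ENNReal.mul_ne_top ENNReal.ofReal_ne_top
      (ENNReal.mul_ne_top ENNReal.ofReal_ne_top (measure_ne_top _ _)))).1 hst
  have hleak : ∀ p : Prop, ∀ _ : Decidable p,
      ENNReal.ofReal δp * (if p then 1 else 0) ≤ ENNReal.ofReal δp := fun p _ => by
    split_ifs <;> simp
  rw [viewProb, viewProb, ENNReal.ofReal_add hδ hδp]
  calc _ ≤ ENNReal.ofReal δp + ENNReal.ofReal (1 - δp) *
        (ENNReal.ofReal (Real.exp ε) * (S.law.prod (noiseLaw T d P.σ))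
          {p | Sum.inr (stateAfter P loss D' S p.1 (Matrix.of p.2) T).sent ∈ V} +
        gaussianHockeyStick (P.σ ^ 2) √(q v) ε) :=
        add_le_add (hleak _ _) (mul_le_mul_right hview _)
    _ ≤ ENNReal.ofReal δp + (ENNReal.ofReal (Real.exp ε) * (ENNReal.ofReal (1 - δp) *
        (S.law.prod (noiseLaw T d P.σ))
          {p | Sum.inr (stateAfter P loss D' S p.1 (Matrix.of p.2) T).sent ∈ V}) +
        ENNReal.ofReal δ) := by
        rw [mul_add, mul_left_comm]
        exact add_le_add_right (add_le_add_right hhs _) _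
    _ ≤ _ := by
        rw [mul_add, add_left_comm, add_comm (ENNReal.ofReal δp)]
        exact add_le_add_left le_add_self _
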